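/- **Setting.** Let $G=(V,E)$ be a connected undirected graph on $n\ge 2$ vertices with Laplacian $L=D-A$. For a symmetric matrix $M$ let $\mathcal R_M=\max_i (M^+)_{ii}$, where $M^+$ is the pseudo-inverse. The PD-Laplacian is $\bar L=L+\mathcal R_L^{-1}\frac1{n^2}J$, with $J$ the all-ones matrix. Let $y:V\to[k]$ assign the vertices to $k$ classes, with indicator matrix $R\in\{0,1\}^{n\times k}$ ($R_{is}=1$ iff $y_i=s$). Let $|\Phi|$ be the number of edges joining different classes, $r_{ij}=(e_i-e_j)^{T}L^+(e_i-e_j)$ the effective resistance, and $r_G=\max_{i,j}r_{ij}$. Let $U=RU^*R^{T}$ for some $U^*\in\{-1,1\}^{k\times k}$; the case $U^*_{ss}=1$, $U^*_{rs}=-1$ ($r\ne s$) is the similarity matrix, with $U_{ij}=1$ if $y_i=y_j$ and $U_{ij}=-1$ otherwise. For a margin $\gamma>0$, the quasi-dimension $\mathcal D^\gamma(U)$ is the infimum of $\mathcal R_{\bar L}\mathrm{Tr}(P^{T}\bar LP)+\mathcal R_{\bar L}\mathrm{Tr}(Q^{T}\bar LQ)$ over all $d$ and all $P,Q\in\mathbb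 R^{n\times d}$ with rows of Euclidean norm $1$ and $PQ^{T}=\gamma U$; $\gamma$ is *feasible* for $U$ if such $P,Q$ exist. Let $\mathcal X_{\widehat{\mathcal D}}$ be the set of all $PQ^{T}$ with $P,Q$ having unit rows and $\mathcal R_{\bar L}\mathrm{Tr}(P^{T}\bar LP)+\mathcal R_{\bar L}\mathrm{Tr}(Q^{T}\bar LQ)\le\widehat{\mathcal D}$. Let $h_\gamma(x)=0$ if $x\ge\gamma$ and $h_\gamma(x)=1-x/\gamma$ otherwise. **Algorithm** (parameters $\gamma,\eta,\widehat{\mathcal D}$). Let $\Gamma$ be the $2n\times 2n$ block diagonal matrix with both blocks $\sqrt{\mathcal R_{\bar L}\bar L}$, and let $\mathcal K$ be the set of positive semidefinite $W\in\mathbb R^{2n\times2n}$ with $W_{vv}\le1$ for all $v$ and $\mathrm{Tr}(\Gamma W\Gamma)\le\widehat{\mathcal D}$. Start with any $W_1\in\mathcal K$. In round $t$ receive $(i_t,j_t)\in V^2$, let $Z_t=\frac12(e_{i_t}e_{n+j_t}^{T}+e_{n+j_t}e_{i_t}^{T})$, predict $\hat y_t=\mathrm{sgn}(W_t\bullet Z_t)\in\{-1,1\}$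 (either sign if the product is $0$), and receive a label $y_t\in\{-1,1\}$. If $\hat y_t\ne y_t$, put $L_t=-\frac{y_t}{\gamma}Z_t$ and $W_{t+1}=\arg\min_{W\in\mathcal K}\big(-\ln\det(\Gamma W\Gamma+I)+\eta\sum_{s\le t}W\bullet L_s\big)$; otherwise put $L_t=0$ and $W_{t+1}=W_t$. Let $M$ be the number of mistakes in $T$ rounds and $\mathrm{hloss}=\min_{X\in\mathcal X_{\widehat{\mathcal D}}}\sum_{t=1}^Th_\gamma(y_tX_{i_t,j_t})$. **Claim.** For every $\delta>0$ there is $c_0>0$ such that for every $c\in(0,c_0]$ there is $C>0$ (depending only on $\delta$ and $c$) such that the following holds for all $n\ge2$, $G$, $k$, $y$. 1. $\mathrm{Tr}(R^{T}LR)=2|\Phi|$ and $\mathcal R_L\le r_G\le4\mathcal R_L$. Every $\gamma\in(0,1/3]$ is feasible for the similarity matrix. Now let $U$ be as above, let $\gamma>0$ be feasible for $U$, and run the algorithm with $\eta=c\gamma^2$. Write "$M\lesssim B$" for: for all $T$, all pairs, all labels in $\{-1,1\}$ and every run, $M\le B+(1+\delta)\,\mathrm{hloss}$, and moreover $M\le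 B+\mathrm{hloss}$ if $y_t=U_{i_t,j_t}$ for all $t\le T$ (in the similarity case: if the label says whether $i_t$ and $j_t$ are in the same class). 2. For every $\widehat{\mathcal D}\ge\mathcal D^\gamma(U)$: the minimisers used by the algorithm exist and are unique, $\gamma U\in\mathcal X_{\widehat{\mathcal D}}$, the minimum defining $\mathrm{hloss}$ is attained, and $M\lesssim C\widehat{\mathcal D}/\gamma^2$. 3. Let $\widehat{\mathcal D}=8\,\mathrm{Tr}(R^{T}LR)\mathcal R_L+4$. Then $\mathcal D^\gamma(U)\le\widehat{\mathcal D}$, and with this $\widehat{\mathcal D}$: - if at least two classes are non-empty, then $$M\lesssim C\,\frac{\mathrm{Tr}(R^{T}LR)\,\mathcal R_L}{\gamma^2}\qquad\text{and}\qquad M\lesssim C\,\frac{|\Phi|\,r_G}{\gamma^2};$$ - if $\mathrm{Tr}(R^{T}LR)\mathcal R_L\le a k$ for a real $a$, then $M\lesssim C(a+1)k/\gamma^2$; - in particular $O(k/\gamma^2)$ holds for graphs with $O(k)$ cut edges and bounded diameter: if $|\Phi|\le ak$ and any two vertices are joined by a path of length at most $d$, then $M\lesssim C(ad+1)k/\gamma^2$.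 -/

import Mathlib

open Matrix

namespace OnlineSimilarity

noncomputable section

/-! ### Pseudo-inverse, square root, squared radius -/

/-- Moore-Penrose pseudo-inverse of a real symmetric matrix: in an orthonormal eigenbasis, invert
the nonzero eigenvalues and keep the zero ones (`0⁻¹ = 0` in `ℝ`). -/
def pinv {ι : Type*} [Fintype ι] [DecidableEq ι] (A : Matrix ι ι ℝ) : Matrix ι ι ℝ :=
  cfc (fun x : ℝ => x⁻¹) A

/-- Positive semidefinite square root of a real positive semidefinite matrix. -/
def msqrt {ι : Type*} [Fintype ι] [DecidableEq ι] (A : Matrix ι ι ℝ) : Matrix ι ι ℝ :=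
  cfc Real.sqrt A

theorem continuousOn_spectrum {ι : Type*} [Fintype ι] [DecidableEq ι] (A : Matrix ι ι ℝ)
    (f : ℝ → ℝ) : ContinuousOn f (spectrum ℝ A) :=
  (Matrix.finite_real_spectrum (A := A)).continuousOn f

/-- The four Penrose equations, which characterise the pseudo-inverse. -/
theorem pinv_penrose {ι : Type*} [Fintype ι] [DecidableEq ι] (A : Matrix ι ι ℝ)
    (hA : A.IsHermitian) :
    A * pinv A * A = A ∧ pinv A * A * pinv A = pinv A ∧
      (A * pinv A)ᵀ = A * pinv A ∧ (pinv A * A)ᵀ = pinv A * A := by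
  have hs : IsSelfAdjoint A := hA
  have c1 := continuousOn_spectrum A (fun x : ℝ => x⁻¹)
  have e0 : cfc (fun x : ℝ => x) A = A := cfc_id' ℝ A
  have e1 : A * pinv A = cfc (fun x : ℝ => x * x⁻¹) A := by
    rw [cfc_mul (fun x : ℝ => x) (fun x : ℝ => x⁻¹) A (continuousOn_spectrum A _) c1, e0]
    rfl
  have e2 : pinv A * A = cfc (fun x : ℝ => x⁻¹ * x) A := by
    rw [cfc_mul (fun x : ℝ => x⁻¹) (fun x : ℝ => x) A c1 (continuousOn_spectrum A _), e0]
    rfl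
  refine ⟨?_, ?_, ?_, ?_⟩
  · rw [e1]
    conv_lhs => rw [← e0]
    rw [cfc_id' ℝ A]
    nth_rewrite 2 [← e0]
    rw [← cfc_mul (fun x : ℝ => x * x⁻¹) (fun x : ℝ => x) A (continuousOn_spectrum A _)
      (continuousOn_spectrum A _)]
    conv_rhs => rw [← e0]
    congr 1
    funext x
    exact mul_inv_mul_cancel x
  · rw [e2]
    unfold pinv
    rw [← cfc_mul (fun x : ℝ => x⁻¹ * x) (fun x : ℝ => x⁻¹) A (continuousOn_spectrum A _) c1]
    congr 1
    funext x
    by_cases hx : x = 0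
    · simp [hx]
    · field_simp
  · rw [e1]
    have h : IsSelfAdjoint (cfc (fun x : ℝ => x * x⁻¹) A) := cfc_predicate _ A
    simpa [star_eq_conjTranspose] using h.star_eq
  · rw [e2]
    have h : IsSelfAdjoint (cfc (fun x : ℝ => x⁻¹ * x) A) := cfc_predicate _ A
    simpa [star_eq_conjTranspose] using h.star_eq

/-- `msqrt A` is a symmetric matrix whose square is `A`. -/
theorem msqrt_mul_self {ι : Type*} [Fintype ι] [DecidableEq ι] (A : Matrix ι ι ℝ)
    (hA : A.PosSemidef) : (msqrt A).IsHermitian ∧ msqrt A * msqrt A = A := by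
  have hs : IsSelfAdjoint A := hA.1
  refine ⟨(cfc_predicate Real.sqrt A : IsSelfAdjoint _), ?_⟩
  unfold msqrt
  rw [← cfc_mul Real.sqrt Real.sqrt A (continuousOn_spectrum A _) (continuousOn_spectrum A _)]
  conv_rhs => rw [← cfc_id' ℝ A]
  refine cfc_congr ?_
  intro x hx
  rw [hA.1.spectrum_real_eq_range_eigenvalues] at hx
  obtain ⟨i, rfl⟩ := hx
  exact Real.mul_self_sqrt (hA.eigenvalues_nonneg i)

/-- Squared radius `R_M = max_i (M⁺)_{ii}`. -/
def sqRadius {ι : Type*} [Fintype ι] [DecidableEq ι] (M : Matrix ι ι ℝ) : ℝ :=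
  ⨆ i, pinv M i i

/-! ### Graph notions -/

section Graph

variable {V : Type*} [Fintype V] [DecidableEq V] (G : SimpleGraph V) [DecidableRel G.Adj]

/-- PD-Laplacian `L + R_L⁻¹ (1/n²) J`, where `L` is the graph Laplacian, `n` the number of
vertices and `J` the all-ones matrix. -/
def pdLaplacian : Matrix V V ℝ :=
  G.lapMatrix ℝ +
    ((sqRadius (G.lapMatrix ℝ))⁻¹ * (1 / (Fintype.card V : ℝ) ^ 2)) • Matrix.of fun _ _ => (1 : ℝ)

/-- Effective resistance `(e_i - e_j)ᵀ L⁺ (e_i - e_j)` (unit resistors on the edges). -/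
def effRes (i j : V) : ℝ :=
  (Pi.single i 1 - Pi.single j 1) ⬝ᵥ
    (pinv (G.lapMatrix ℝ) *ᵥ (Pi.single i 1 - Pi.single j 1))

/-- Resistance diameter: the largest effective resistance between two vertices. -/
def resDiam : ℝ := ⨆ p : V × V, effRes G p.1 p.2

end Graph

/-- Cut-size: the number of (undirected) edges whose end points are in different classes. -/
def cutSize {V : Type*} (G : SimpleGraph V) {k : ℕ} (y : V → Fin k) : ℕ :=
  {e ∈ G.edgeSet | ¬ (e.map y).IsDiag}.ncard

/-- Class indicator matrix `R ∈ {0,1}^{V × k}`: `R_{i,s} = 1` iff vertex `i` is in class `s`. -/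
def classMatrix {V : Type*} {k : ℕ} (y : V → Fin k) : Matrix V (Fin k) ℝ :=
  Matrix.of fun i s => if y i = s then 1 else 0

/-- `1` if two vertices are in the same class, `-1` otherwise. -/
def simMatrix {V : Type*} {k : ℕ} (y : V → Fin k) : Matrix V V ℝ :=
  Matrix.of fun i j => if y i = y j then 1 else -1

/-- The similarity matrix is `R U* Rᵀ` with `U*` equal to `1` on the diagonal and `-1` off it. -/
theorem simMatrix_eq {V : Type*} {k : ℕ} (y : V → Fin k) :
    simMatrix y = classMatrix y * simMatrix (id : Fin k → Fin k) * (classMatrix y)ᵀ := by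
  ext i j
  simp only [simMatrix, classMatrix, Matrix.mul_apply, Matrix.of_apply, Matrix.transpose_apply, id]
  rw [Finset.sum_eq_single (y j) (by intro b _ hb; simp [hb.symm]) (by simp)]
  rw [Finset.sum_eq_single (y i) (by intro b _ hb; simp [hb.symm]) (by simp)]
  simp

/-- `Tr(Rᵀ L R) · R_L`. -/
def cutComplexity {V : Type*} [Fintype V] [DecidableEq V] (G : SimpleGraph V)
    [DecidableRel G.Adj] {k : ℕ} (y : V → Fin k) : ℝ :=
  ((classMatrix y)ᵀ * G.lapMatrix ℝ * classMatrix y).trace * sqRadius (G.lapMatrix ℝ)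

/-! ### Comparators -/

/-- All rows have Euclidean norm `1`. -/
def RowNormalized {ι : Type*} {d : ℕ} (P : Matrix ι (Fin d) ℝ) : Prop :=
  ∀ i, ∑ a, P i a ^ 2 = 1

section Comparators

variable {V : Type*} [Fintype V] [DecidableEq V]

/-- `R_M Tr(Pᵀ M P) + R_N Tr(Qᵀ N Q)`. -/
def sideCost (M N : Matrix V V ℝ) {d : ℕ} (P Q : Matrix V (Fin d) ℝ) : ℝ :=
  sqRadius M * (Pᵀ * M * P).trace + sqRadius N * (Qᵀ * N * Q).trace

/-- The values minimised in the definition of the quasi-dimension of `U` at margin `γ`; the set is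
nonempty iff `γ U` has a row-normalised factorisation, i.e. iff the max norm of `U` is at most
`1 / γ`. -/
def quasiDimValues (γ : ℝ) (M N U : Matrix V V ℝ) : Set ℝ :=
  {r | ∃ (d : ℕ) (P Q : Matrix V (Fin d) ℝ), RowNormalized P ∧ RowNormalized Q ∧
    P * Qᵀ = γ • U ∧ r = sideCost M N P Q}

/-- Quasi-dimension of `U` with side information `M`, `N` at margin `γ`. -/
def quasiDim (γ : ℝ) (M N U : Matrix V V ℝ) : ℝ := sInf (quasiDimValues γ M N U)

/-- The comparator class: products `P Qᵀ` of row-normalised matrices with `sideCost` at most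
`Dhat`. -/
def comparators (M N : Matrix V V ℝ) (Dhat : ℝ) : Set (Matrix V V ℝ) :=
  {X | ∃ (d : ℕ) (P Q : Matrix V (Fin d) ℝ), RowNormalized P ∧ RowNormalized Q ∧
    sideCost M N P Q ≤ Dhat ∧ X = P * Qᵀ}

/-- Hinge loss at margin `γ`. -/
def hinge (γ x : ℝ) : ℝ := if γ ≤ x then 0 else 1 - x / γ

/-- Cumulative hinge loss of `X` on the first `T` rounds. -/
def hingeLoss (γ : ℝ) (T : ℕ) (i j : ℕ → V) (lab : ℕ → ℝ) (X : Matrix V V ℝ) : ℝ :=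
  ∑ t ∈ Finset.range T, hinge γ (lab t * X (i t) (j t))

/-- Smallest cumulative hinge loss over the comparator class. -/
def minHingeLoss (γ : ℝ) (M N : Matrix V V ℝ) (Dhat : ℝ) (T : ℕ) (i j : ℕ → V)
    (lab : ℕ → ℝ) : ℝ :=
  sInf (hingeLoss γ T i j lab '' comparators M N Dhat)

/-! ### The algorithm -/

/-- `Γ`, the block diagonal matrix with blocks `√(R_M M)` and `√(R_N N)`. -/
def sideGamma (M N : Matrix V V ℝ) : Matrix (V ⊕ V) (V ⊕ V) ℝ :=
  Matrix.fromBlocks (msqrt (sqRadius M • M)) 0 0 (msqrt (sqRadius N • N))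

/-- Frobenius inner product. -/
def frob {ι : Type*} [Fintype ι] (A B : Matrix ι ι ℝ) : ℝ := (Aᵀ * B).trace

/-- Decision set: positive semidefinite, diagonal at most `1`, `Γ`-trace norm at most `Dhat`. -/
def decisionSet (Γ : Matrix (V ⊕ V) (V ⊕ V) ℝ) (Dhat : ℝ) : Set (Matrix (V ⊕ V) (V ⊕ V) ℝ) :=
  {W | W.PosSemidef ∧ (∀ v, W v v ≤ 1) ∧ (Γ * W * Γ).trace ≤ Dhat}

/-- The sparse matrix `Z⟨i,j⟩ = (e_i e_{n+j}ᵀ + e_{n+j} e_iᵀ) / 2`. -/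
def sparseZ (i j : V) : Matrix (V ⊕ V) (V ⊕ V) ℝ :=
  (1 / 2 : ℝ) • (Matrix.single (Sum.inl i) (Sum.inr j) 1 + Matrix.single (Sum.inr j) (Sum.inl i) 1)

/-- FTRL objective with the `Γ`-dependent log-determinant regulariser
(`A` is the sum of the past loss matrices). -/
def ftrlObjective (Γ : Matrix (V ⊕ V) (V ⊕ V) ℝ) (η : ℝ) (A W : Matrix (V ⊕ V) (V ⊕ V) ℝ) : ℝ :=
  -Real.log (Γ * W * Γ + 1).det + η * frob W A

/-- `W` minimises the FTRL objective over the decision set. -/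
def IsFTRL (Γ : Matrix (V ⊕ V) (V ⊕ V) ℝ) (Dhat η : ℝ) (A W : Matrix (V ⊕ V) (V ⊕ V) ℝ) : Prop :=
  W ∈ decisionSet Γ Dhat ∧
    ∀ W' ∈ decisionSet Γ Dhat, ftrlObjective Γ η A W ≤ ftrlObjective Γ η A W'

/-- Loss matrix of round `t`: `-(y_t/γ) Z⟨i_t,j_t⟩` on a mistake, `0` otherwise. -/
def lossMatrix (γ : ℝ) (i j : ℕ → V) (lab yhat : ℕ → ℝ) (t : ℕ) : Matrix (V ⊕ V) (V ⊕ V) ℝ :=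
  open Classical in
  if yhat t ≠ lab t then (-(lab t) / γ) • sparseZ (i t) (j t) else 0

/-- `W`, `yhat` are matrices and predictions produced by the mistake-driven FTRL algorithm on the
pairs `(i t, j t)` with revealed labels `lab t`, for `T` rounds (numbered from `0`). The initial
matrix is any element of the decision set; `yhat t` is the sign of `W_t • Z_t`, and either sign is
allowed when that number is `0`. -/
structure IsRun (Γ : Matrix (V ⊕ V) (V ⊕ V) ℝ) (γ Dhat η : ℝ) (T : ℕ) (i j : ℕ → V)
    (lab : ℕ → ℝ) (W : ℕ → Matrix (V ⊕ V) (V ⊕ V) ℝ) (yhat : ℕ → ℝ) : Prop where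
  init : W 0 ∈ decisionSet Γ Dhat
  pred_sign : ∀ t < T, yhat t = 1 ∨ yhat t = -1
  pred_pos : ∀ t < T, 0 < frob (W t) (sparseZ (i t) (j t)) → yhat t = 1
  pred_neg : ∀ t < T, frob (W t) (sparseZ (i t) (j t)) < 0 → yhat t = -1
  keep : ∀ t < T, yhat t = lab t → W (t + 1) = W t
  update : ∀ t < T, yhat t ≠ lab t →
    IsFTRL Γ Dhat η (∑ s ∈ Finset.range (t + 1), lossMatrix γ i j lab yhat s) (W (t + 1))

/-- Number of mistakes in `T` rounds. -/
def mistakes (T : ℕ) (lab yhat : ℕ → ℝ) : ℕ :=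
  open Classical in ((Finset.range T).filter fun t => yhat t ≠ lab t).card

/-- Mistake bound with leading term `B` for the algorithm with side information `M` in both
blocks, quasi-dimension estimate `Dhat` and step size `η`, for every number of rounds, sequence of
pairs and `±1` labels, and every run. The hinge loss has factor `1 + δ` for arbitrary labels and
factor `1` if the labels are those of `U`. -/
def MistakeBound (M U : Matrix V V ℝ) (γ Dhat η δ B : ℝ) : Prop :=
  ∀ (T : ℕ) (i j : ℕ → V) (lab : ℕ → ℝ) (W : ℕ → Matrix (V ⊕ V) (V ⊕ V) ℝ) (yhat : ℕ → ℝ),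
    (∀ t < T, lab t = 1 ∨ lab t = -1) →
    IsRun (sideGamma M M) γ Dhat η T i j lab W yhat →
      (mistakes T lab yhat : ℝ) ≤ B + (1 + δ) * minHingeLoss γ M M Dhat T i j lab ∧
      ((∀ t < T, lab t = U (i t) (j t)) →
        (mistakes T lab yhat : ℝ) ≤ B + minHingeLoss γ M M Dhat T i j lab)

end Comparators

end

end OnlineSimilarity

open OnlineSimilarity

/-!
The regularizer `-log det (Γ W Γ + 1)` is strongly convex in every single entry of `W`. After
normalising the midpoint of `W` and `W'` to the identity this is
`tr N² ≤ -log det (1 + N) - log det (1 - N)`, and the normalisation costs a constant because the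
diagonal of `Γ⁻²` is at most `1`. A mistake changes the objective in one entry only, and the
current iterate has nonnegative loss on it, so it lowers the minimum by at most `4 (η / γ)²`; only
the first mistake, where the iterate is arbitrary, may cost `η / γ` instead.
Evaluating the final objective at the block matrix of a comparator `X`, whose cumulative loss is at
most `hingeLoss X - M`, gives `(1 - 4 η / γ²) M ≤ hingeLoss X + D / η + 1 / γ`. With `η = c γ²` the
factor `1 - 4 c` is absorbed by `1 + δ` and by the constant; if the labels are those of `U`, the
comparator `γ U` has hinge loss `0` and nothing has to be absorbed.

Comparators are the off-diagonal blocks of correlation matrices, a compact set, so that the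
quasi-dimension and the hinge-loss minimum are attained.

A feasible pair `P, Q` may be taken constant on classes; then each cut edge contributes at most `4`
to `Tr(Pᵀ L P)`, twice its contribution to `Tr(Rᵀ L R)`, and since the inverse of the PD-Laplacian
is `L⁺ + R_L J`, its squared radius is `2 R_L`. The bounds in terms of resistances come from
`(x i - x j)² ≤ r_{ij} xᵀ L x`, the Cauchy-Schwarz inequality against the potential of the unit
current from `i` to `j`.
-/

namespace OnlineSimilarity

/-! ### Positive semidefinite matrices and log-determinants -/

section PosSemidef

variable {ι : Type*}

theorem posDef_add_one [DecidableEq ι] {S : Matrix ι ι ℝ} (hS : S.PosSemidef) :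
    (S + 1).PosDef :=
  PosDef.posSemidef_add hS PosDef.one

theorem posSemidef_of_const_one [Finite ι] :
    (of fun _ _ => (1 : ℝ) : Matrix ι ι ℝ).PosSemidef := by
  simpa [vecMulVec] using posSemidef_vecMulVec_self_star (fun _ : ι => (1 : ℝ))

theorem isClosed_setOf_posSemidef [Finite ι] :
    IsClosed {W : Matrix ι ι ℝ | W.PosSemidef} := by
  cases nonempty_fintype ι
  simp only [posSemidef_iff_dotProduct_mulVec, Set.ofPred_and, Set.ofPred_forall, IsHermitian]
  refine IsClosed.inter (isClosed_eq (by fun_prop) continuous_id) (isClosed_iInter fun x => ?_)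
  exact isClosed_le continuous_const (by simp only [dotProduct, mulVec]; fun_prop)

variable [Fintype ι]

theorem dotProduct_mul_mul_mulVec {A : Matrix ι ι ℝ} (hA : A.IsHermitian) (B : Matrix ι ι ℝ)
    (u v : ι → ℝ) : u ⬝ᵥ (A * B * A) *ᵥ v = (A *ᵥ u) ⬝ᵥ B *ᵥ (A *ᵥ v) := by
  rw [← mulVec_mulVec, ← mulVec_mulVec, dotProduct_mulVec, ← mulVec_transpose,
    ← conjTranspose_eq_transpose_of_trivial, hA.eq]

theorem dotProduct_mul_self_mulVec {A : Matrix ι ι ℝ} (hA : A.IsHermitian) (u v : ι → ℝ) :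
    u ⬝ᵥ (A * A) *ᵥ v = (A *ᵥ u) ⬝ᵥ (A *ᵥ v) := by
  classical
  simpa using dotProduct_mul_mul_mulVec hA 1 u v

theorem sq_dotProduct_le (u v : ι → ℝ) : (u ⬝ᵥ v) ^ 2 ≤ (u ⬝ᵥ u) * (v ⬝ᵥ v) := by
  simpa only [dotProduct, ← sq] using Finset.sum_mul_sq_le_sq_mul_sq Finset.univ u v

theorem sq_dotProduct_mulVec_le (N : Matrix ι ι ℝ) (u v : ι → ℝ) :
    (u ⬝ᵥ N *ᵥ v) ^ 2 ≤ (u ⬝ᵥ u) * (v ⬝ᵥ v) * (Nᵀ * N).trace := by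
  have hNv : (N *ᵥ v) ⬝ᵥ (N *ᵥ v) ≤ (v ⬝ᵥ v) * (Nᵀ * N).trace := by
    calc (N *ᵥ v) ⬝ᵥ (N *ᵥ v) = ∑ a, (N a ⬝ᵥ v) ^ 2 :=
          Finset.sum_congr rfl fun a _ => (sq _).symm
      _ ≤ ∑ a, (N a ⬝ᵥ N a) * (v ⬝ᵥ v) := Finset.sum_le_sum fun a _ => sq_dotProduct_le _ _
      _ = (v ⬝ᵥ v) * (N * Nᵀ).trace := by
          rw [← Finset.sum_mul, mul_comm]
          rfl
      _ = (v ⬝ᵥ v) * (Nᵀ * N).trace := by rw [trace_mul_comm]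
  rw [mul_assoc]
  exact (sq_dotProduct_le _ _).trans
    (mul_le_mul_of_nonneg_left hNv (dotProduct_self_star_nonneg u))

theorem dotProduct_mulVec_nonneg_of_posSemidef {A : Matrix ι ι ℝ} (hA : A.PosSemidef)
    (u : ι → ℝ) : 0 ≤ u ⬝ᵥ A *ᵥ u := by
  simpa using hA.dotProduct_mulVec_nonneg u

theorem posSemidef_mul_mul_of_isHermitian {A B : Matrix ι ι ℝ} (hA : A.IsHermitian)
    (hB : B.PosSemidef) : (A * B * A).PosSemidef := by
  have h := hB.mul_mul_conjTranspose_same A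
  rwa [hA.eq] at h

theorem trace_transpose_mul_mul {κ : Type*} [Fintype κ] (A : Matrix ι ι ℝ) (P : Matrix ι κ ℝ) :
    (Pᵀ * A * P).trace = ∑ a, P.col a ⬝ᵥ A *ᵥ P.col a := by
  refine Finset.sum_congr rfl fun a _ => ?_
  rw [diag, Matrix.mul_assoc, mul_apply]
  rfl

theorem trace_transpose_mul_mul_nonneg {κ : Type*} [Fintype κ] {A : Matrix ι ι ℝ}
    (hA : A.PosSemidef) (P : Matrix ι κ ℝ) : 0 ≤ (Pᵀ * A * P).trace := by
  simpa using (hA.conjTranspose_mul_mul_same P).trace_nonneg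

theorem sq_dotProduct_mulVec_le_of_posSemidef {A : Matrix ι ι ℝ} (hA : A.PosSemidef)
    (u v : ι → ℝ) : (u ⬝ᵥ A *ᵥ v) ^ 2 ≤ (u ⬝ᵥ A *ᵥ u) * (v ⬝ᵥ A *ᵥ v) := by
  classical
  obtain ⟨hB, hBB⟩ := msqrt_mul_self A hA
  rw [← hBB]
  simp only [dotProduct_mul_self_mulVec hB]
  exact sq_dotProduct_le _ _

theorem dotProduct_mulVec_le_trace {S : Matrix ι ι ℝ} (hS : S.PosSemidef) (u : ι → ℝ) :
    u ⬝ᵥ S *ᵥ u ≤ (u ⬝ᵥ u) * S.trace := by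
  classical
  obtain ⟨hB, hBB⟩ := msqrt_mul_self S hS
  have hBt : (msqrt S)ᵀ = msqrt S := by simpa using hB.eq
  have hsq := sq_dotProduct_mulVec_le (msqrt S) u (msqrt S *ᵥ u)
  have hSu := dotProduct_mul_self_mulVec hB u u
  rw [mulVec_mulVec, hBt, hBB, ← hSu, hBB] at hsq
  rcases (dotProduct_mulVec_nonneg_of_posSemidef hS u).eq_or_lt with h0 | hpos
  · rw [← h0]
    exact mul_nonneg (dotProduct_self_star_nonneg u) hS.trace_nonneg
  · refine le_of_mul_le_mul_right ?_ hpos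
    linarith

variable [DecidableEq ι]

theorem log_det_eq_sum_log_eigenvalues {A : Matrix ι ι ℝ} (hA : A.PosDef) :
    Real.log A.det = ∑ i, Real.log (hA.1.eigenvalues i) := by
  rw [hA.1.det_eq_prod_eigenvalues, ← Real.log_prod fun i _ => (hA.eigenvalues_pos i).ne']
  simp

theorem log_det_le_trace_sub_card {A : Matrix ι ι ℝ} (hA : A.PosDef) :
    Real.log A.det ≤ A.trace - Fintype.card ι := by
  calc Real.log A.det ≤ ∑ i, (hA.1.eigenvalues i - 1) := by
        rw [log_det_eq_sum_log_eigenvalues hA]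
        exact Finset.sum_le_sum fun i _ => Real.log_le_sub_one_of_pos (hA.eigenvalues_pos i)
    _ = A.trace - Fintype.card ι := by
        rw [hA.1.trace_eq_sum_eigenvalues]
        simp

theorem log_det_add_one_le_trace {S : Matrix ι ι ℝ} (hS : S.PosSemidef) :
    Real.log (S + 1).det ≤ S.trace := by
  simpa using log_det_le_trace_sub_card (posDef_add_one hS)

theorem log_det_add_one_nonneg {S : Matrix ι ι ℝ} (hS : S.PosSemidef) :
    0 ≤ Real.log (S + 1).det := by
  have hA := posDef_add_one hS
  rw [log_det_eq_sum_log_eigenvalues hA]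
  refine Finset.sum_nonneg fun i _ => Real.log_nonneg ?_
  set v : ι → ℝ := (hA.1.eigenvectorBasis i).ofLp with hv_def
  have hv : v ⬝ᵥ v = 1 := by
    have h := inner_self_eq_one_of_norm_eq_one (𝕜 := ℝ) (hA.1.eigenvectorBasis.orthonormal.1 i)
    rwa [EuclideanSpace.inner_eq_star_dotProduct, star_trivial] at h
  have heig : hA.1.eigenvalues i = v ⬝ᵥ S *ᵥ v + v ⬝ᵥ v := by
    simp [hA.1.eigenvalues_eq, add_mulVec, hv_def]
  rw [heig, hv]
  linarith [dotProduct_mulVec_nonneg_of_posSemidef hS v]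

/-- `1 - N² = ½ ((1 + N) (1 - N) (1 + N) + (1 - N) (1 + N) (1 - N))` is positive definite, and
`tr (1 - N²) - card ι` bounds its log-determinant. -/
theorem trace_mul_self_le_neg_log_det {N : Matrix ι ι ℝ} (hadd : (1 + N).PosDef)
    (hsub : (1 - N).PosDef) :
    (N * N).trace ≤ -Real.log (1 + N).det - Real.log (1 - N).det := by
  have hfactor : (1 + N) * (1 - N) = 1 - N * N := by noncomm_ring
  have hconj : ∀ {A B : Matrix ι ι ℝ}, A.PosDef → B.PosDef → (A * B * A).PosDef := by
    intro A B hA hB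
    have h := hB.mul_mul_conjTranspose_same (vecMul_injective_of_isUnit hA.isUnit)
    rwa [hA.1.eq] at h
  have hpos : ((1 + N) * (1 - N)).PosDef := by
    have hsum : (1 + N) * (1 - N) =
        (1 / 2 : ℝ) • ((1 + N) * (1 - N) * (1 + N) + (1 - N) * (1 + N) * (1 - N)) := by
      rw [show (1 + N) * (1 - N) * (1 + N) + (1 - N) * (1 + N) * (1 - N) =
        (2 : ℝ) • ((1 + N) * (1 - N)) by rw [two_smul]; noncomm_ring, smul_smul]
      norm_num
    rw [hsum]
    exact ((hconj hadd hsub).add (hconj hsub hadd)).smul one_half_pos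
  have h := log_det_le_trace_sub_card hpos
  rw [det_mul, Real.log_mul hadd.det_pos.ne' hsub.det_pos.ne', hfactor, trace_sub,
    trace_one] at h
  linarith

theorem sq_dotProduct_mulVec_le_neg_log_det {N : Matrix ι ι ℝ} (hadd : (1 + N).PosDef)
    (hsub : (1 - N).PosDef) (u v : ι → ℝ) :
    (u ⬝ᵥ N *ᵥ v) ^ 2 ≤
      (u ⬝ᵥ u) * (v ⬝ᵥ v) * (-Real.log (1 + N).det - Real.log (1 - N).det) := by
  have hN : Nᵀ = N := by
    have h : (1 + N)ᵀ = 1 + N := by simpa using hadd.1.eq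
    rwa [transpose_add, transpose_one, add_right_inj] at h
  have h := sq_dotProduct_mulVec_le N u v
  rw [hN] at h
  exact h.trans (mul_le_mul_of_nonneg_left (trace_mul_self_le_neg_log_det hadd hsub)
    (mul_nonneg (dotProduct_self_star_nonneg u) (dotProduct_self_star_nonneg v)))

theorem sq_dotProduct_mulVec_le_log_det {M D : Matrix ι ι ℝ} (hM : M.PosDef)
    (hadd : (M + D).PosDef) (hsub : (M - D).PosDef) (u v : ι → ℝ) :
    (u ⬝ᵥ D *ᵥ v) ^ 2 ≤ (u ⬝ᵥ M *ᵥ u) * (v ⬝ᵥ M *ᵥ v) *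
      (2 * Real.log M.det - Real.log (M + D).det - Real.log (M - D).det) := by
  obtain ⟨hS, hSS⟩ := msqrt_mul_self M hM.posSemidef
  set S := msqrt M
  have hSu : IsUnit S.det := by
    have h := hM.det_pos.ne'
    rw [← hSS, det_mul] at h
    exact (left_ne_zero_of_mul h).isUnit
  obtain ⟨N, rfl⟩ : ∃ N, S * N * S = D :=
    ⟨S⁻¹ * D * S⁻¹, by
      rw [← Matrix.mul_assoc, ← Matrix.mul_assoc, mul_nonsing_inv _ hSu, Matrix.one_mul,
        Matrix.mul_assoc, nonsing_inv_mul _ hSu, Matrix.mul_one]⟩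
  have hconj : ∀ {Z : Matrix ι ι ℝ}, (S * Z * S).PosDef ↔ Z.PosDef := by
    intro Z
    have h := ((isUnit_iff_isUnit_det S).mpr hSu).posDef_star_right_conjugate_iff (x := Z)
    rwa [star_eq_conjTranspose, hS.eq] at h
  have hlog : ∀ {Z : Matrix ι ι ℝ}, Z.PosDef →
      Real.log (S * Z * S).det = Real.log M.det + Real.log Z.det := by
    intro Z hZ
    rw [← Real.log_mul hM.det_pos.ne' hZ.det_pos.ne', ← hSS, det_mul, det_mul, det_mul,
      mul_right_comm]
  have eadd : M + S * N * S = S * (1 + N) * S := by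
    rw [← hSS]
    noncomm_ring
  have esub : M - S * N * S = S * (1 - N) * S := by
    rw [← hSS]
    noncomm_ring
  rw [eadd, hconj] at hadd
  rw [esub, hconj] at hsub
  have h := sq_dotProduct_mulVec_le_neg_log_det hadd hsub (S *ᵥ u) (S *ᵥ v)
  rw [← dotProduct_mul_mul_mulVec hS, ← dotProduct_mul_self_mulVec hS,
    ← dotProduct_mul_self_mulVec hS, hSS] at h
  rw [eadd, esub, hlog hadd, hlog hsub]
  convert h using 2
  ring

end PosSemidef

theorem abs_apply_le_one_of_posSemidef {ι : Type*} [Finite ι] {W : Matrix ι ι ℝ}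
    (hW : W.PosSemidef) (hd : ∀ v, W v v ≤ 1) (a b : ι) : |W a b| ≤ 1 := by
  classical
  cases nonempty_fintype ι
  have h := sq_dotProduct_mulVec_le_of_posSemidef hW (Pi.single a 1) (Pi.single b 1)
  simp only [mulVec_single_one, single_one_dotProduct, col_apply] at h
  exact (sq_le_one_iff_abs_le_one _).mp
    (h.trans (mul_le_one₀ (hd a) hW.diag_nonneg (hd b)))

/-! ### Strong convexity of the objective -/

section DecisionSet

/-- Correlation matrices: the Gram matrices of families of unit vectors. -/
def elliptope (ι : Type*) : Set (Matrix ι ι ℝ) :=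
  {W | W.PosSemidef ∧ ∀ v, W v v = 1}

/-- The matrices `Γ` for which `W ↦ -log det (Γ W Γ + 1)` is strongly convex along every entry of
`W`: symmetric, with every coordinate vector the image of a vector of norm at most `1`. For an
invertible `Γ` the second condition says that the diagonal entries of `Γ⁻²` are at most `1`. -/
structure IsRegularizer {ι : Type*} [Fintype ι] [DecidableEq ι] (Γ : Matrix ι ι ℝ) : Prop where
  isHermitian : Γ.IsHermitian
  exists_preimage : ∀ v, ∃ g, Γ *ᵥ g = Pi.single v 1 ∧ g ⬝ᵥ g ≤ 1

theorem isCompact_setOf_posSemidef_diag_le_one {ι : Type*} [Finite ι] :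
    IsCompact {W : Matrix ι ι ℝ | W.PosSemidef ∧ ∀ v, W v v ≤ 1} := by
  have hcube : IsCompact (Set.pi Set.univ fun _ : ι => Set.pi Set.univ fun _ : ι =>
      Set.Icc (-1 : ℝ) 1) :=
    isCompact_univ_pi fun _ => isCompact_univ_pi fun _ => isCompact_Icc
  refine hcube.of_isClosed_subset ?_ fun W hW a _ b _ =>
    abs_le.mp (abs_apply_le_one_of_posSemidef hW.1 hW.2 a b)
  simp only [Set.ofPred_and, Set.ofPred_forall]
  exact isClosed_setOf_posSemidef.inter
    (isClosed_iInter fun v => isClosed_le (by fun_prop) continuous_const)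

theorem isCompact_elliptope {ι : Type*} [Finite ι] : IsCompact (elliptope ι) := by
  refine isCompact_setOf_posSemidef_diag_le_one.of_isClosed_subset ?_
    fun W hW => ⟨hW.1, fun v => (hW.2 v).le⟩
  simp only [elliptope, Set.ofPred_and, Set.ofPred_forall]
  exact isClosed_setOf_posSemidef.inter
    (isClosed_iInter fun v => isClosed_eq (by fun_prop) continuous_const)

theorem frob_add_right {ι : Type*} [Fintype ι] (W A B : Matrix ι ι ℝ) :
    frob W (A + B) = frob W A + frob W B := by
  simp only [frob, Matrix.mul_add, trace_add]

theorem frob_midpoint {ι : Type*} [Fintype ι] (W W' A : Matrix ι ι ℝ) :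
    2 * frob ((1 / 2 : ℝ) • (W + W')) A = frob W A + frob W' A := by
  simp only [frob, transpose_smul, transpose_add, smul_mul_assoc, Matrix.add_mul, trace_smul,
    trace_add, smul_eq_mul]
  ring

theorem IsRegularizer.dotProduct_mulVec_mem_Ioc {ι : Type*} [Fintype ι] [DecidableEq ι]
    {Γ W : Matrix ι ι ℝ} (hΓ : IsRegularizer Γ) (hW : W.PosSemidef) {v : ι} (hv : W v v ≤ 1)
    {g : ι → ℝ} (hg : Γ *ᵥ g = Pi.single v 1) (hg1 : g ⬝ᵥ g ≤ 1) :
    g ⬝ᵥ (Γ * W * Γ + 1) *ᵥ g ∈ Set.Ioc 0 2 := by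
  have hg0 : g ≠ 0 := by
    rintro rfl
    rw [mulVec_zero, eq_comm, Pi.single_eq_zero_iff] at hg
    exact one_ne_zero hg
  have hquad : g ⬝ᵥ (Γ * W * Γ) *ᵥ g = W v v := by
    rw [dotProduct_mul_mul_mulVec hΓ.isHermitian, hg, mulVec_single_one, single_one_dotProduct,
      col_apply]
  rw [add_mulVec, dotProduct_add, hquad, one_mulVec]
  have hpos : 0 < g ⬝ᵥ g := by simpa using dotProduct_self_star_pos_iff.mpr hg0
  constructor <;> linarith [hW.diag_nonneg (i := v)]

variable {V : Type*} [Fintype V] {Γ : Matrix (V ⊕ V) (V ⊕ V) ℝ} {Dhat : ℝ}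
  {W W' : Matrix (V ⊕ V) (V ⊕ V) ℝ}

theorem isCompact_decisionSet (Γ : Matrix (V ⊕ V) (V ⊕ V) ℝ) (Dhat : ℝ) :
    IsCompact (decisionSet Γ Dhat) := by
  have hset : decisionSet Γ Dhat =
      {W | W.PosSemidef ∧ ∀ v, W v v ≤ 1} ∩ {W | (Γ * W * Γ).trace ≤ Dhat} := by
    ext W
    exact and_assoc.symm
  rw [hset]
  exact isCompact_setOf_posSemidef_diag_le_one.inter_right
    (isClosed_le (by fun_prop) continuous_const)

theorem midpoint_mem_decisionSet (h : W ∈ decisionSet Γ Dhat) (h' : W' ∈ decisionSet Γ Dhat) :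
    (1 / 2 : ℝ) • (W + W') ∈ decisionSet Γ Dhat := by
  refine ⟨(h.1.add h'.1).smul (by norm_num), fun v => ?_, ?_⟩
  · simp only [Matrix.smul_apply, Matrix.add_apply, smul_eq_mul]
    linarith [h.2.1 v, h'.2.1 v]
  · simp only [mul_smul_comm, smul_mul_assoc, Matrix.mul_add, Matrix.add_mul, trace_smul, trace_add,
      smul_eq_mul]
    linarith [h.2.2, h'.2.2]

variable [DecidableEq V] {η : ℝ} {A : Matrix (V ⊕ V) (V ⊕ V) ℝ}

theorem one_le_of_mem_decisionSet (hΓ : IsRegularizer Γ) (hW : W ∈ decisionSet Γ Dhat)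
    {v : V ⊕ V} (hv : W v v = 1) : 1 ≤ Dhat := by
  obtain ⟨g, hg, hg1⟩ := hΓ.exists_preimage v
  have hS := posSemidef_mul_mul_of_isHermitian hΓ.isHermitian hW.1
  calc (1 : ℝ) = g ⬝ᵥ (Γ * W * Γ) *ᵥ g := by
        rw [dotProduct_mul_mul_mulVec hΓ.isHermitian, hg, mulVec_single_one,
          single_one_dotProduct, col_apply, hv]
    _ ≤ (g ⬝ᵥ g) * (Γ * W * Γ).trace := dotProduct_mulVec_le_trace hS g
    _ ≤ (Γ * W * Γ).trace := mul_le_of_le_one_left hS.trace_nonneg hg1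
    _ ≤ Dhat := hW.2.2

/-- Strong convexity along every entry `(a, b)`: the log-determinant inequality applied to the
preimages of the coordinate vectors `a` and `b`. -/
theorem ftrlObjective_midpoint (hΓ : IsRegularizer Γ) (hW : W ∈ decisionSet Γ Dhat)
    (hW' : W' ∈ decisionSet Γ Dhat) (a b : V ⊕ V) :
    2 * ftrlObjective Γ η A ((1 / 2 : ℝ) • (W + W')) + (W a b - W' a b) ^ 2 / 16 ≤
      ftrlObjective Γ η A W + ftrlObjective Γ η A W' := by
  have hposDef : ∀ {Z}, Z ∈ decisionSet Γ Dhat → (Γ * Z * Γ + 1).PosDef := fun hZ =>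
    posDef_add_one (posSemidef_mul_mul_of_isHermitian hΓ.isHermitian hZ.1)
  have hX := midpoint_mem_decisionSet hW hW'
  set X := (1 / 2 : ℝ) • (W + W') with hX_def
  have hadd : Γ * X * Γ + 1 + Γ * ((1 / 2 : ℝ) • (W - W')) * Γ = Γ * W * Γ + 1 := by
    simp only [hX_def, mul_smul_comm, smul_mul_assoc, Matrix.mul_add, Matrix.add_mul,
      Matrix.mul_sub, Matrix.sub_mul]
    module
  have hsub : Γ * X * Γ + 1 - Γ * ((1 / 2 : ℝ) • (W - W')) * Γ = Γ * W' * Γ + 1 := by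
    simp only [hX_def, mul_smul_comm, smul_mul_assoc, Matrix.mul_add, Matrix.add_mul,
      Matrix.mul_sub, Matrix.sub_mul]
    module
  obtain ⟨g, hg, hg1⟩ := hΓ.exists_preimage a
  obtain ⟨f, hf, hf1⟩ := hΓ.exists_preimage b
  have hlog := sq_dotProduct_mulVec_le_log_det (hposDef hX) (hadd ▸ hposDef hW)
    (hsub ▸ hposDef hW') g f
  rw [hadd, hsub, dotProduct_mul_mul_mulVec hΓ.isHermitian, hg, hf, mulVec_single_one,
    single_one_dotProduct, col_apply, Matrix.smul_apply, Matrix.sub_apply, smul_eq_mul] at hlog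
  obtain ⟨hp0, hp⟩ := hΓ.dotProduct_mulVec_mem_Ioc hX.1 (hX.2.1 a) hg hg1
  obtain ⟨hq0, hq⟩ := hΓ.dotProduct_mulVec_mem_Ioc hX.1 (hX.2.1 b) hf hf1
  have hgap := (mul_nonneg_iff_of_pos_left (mul_pos hp0 hq0)).mp ((sq_nonneg _).trans hlog)
  have hbound := hlog.trans
    (mul_le_mul_of_nonneg_right (mul_le_mul hp hq hq0.le zero_le_two) hgap)
  simp only [ftrlObjective]
  linear_combination hbound / 4 + η * frob_midpoint W W' A

theorem IsFTRL.add_sq_le (hΓ : IsRegularizer Γ) (hW : IsFTRL Γ Dhat η A W)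
    (hW' : W' ∈ decisionSet Γ Dhat) (a b : V ⊕ V) :
    ftrlObjective Γ η A W + (W a b - W' a b) ^ 2 / 16 ≤ ftrlObjective Γ η A W' := by
  linarith [ftrlObjective_midpoint (η := η) (A := A) hΓ hW.1 hW' a b,
    hW.2 _ (midpoint_mem_decisionSet hW.1 hW')]

theorem IsFTRL.sub_sq_le (hΓ : IsRegularizer Γ) (hW : IsFTRL Γ Dhat η A W)
    (hW' : W' ∈ decisionSet Γ Dhat) (β : ℝ) (a b : V ⊕ V) :
    ftrlObjective Γ η A W - 4 * β ^ 2 ≤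
      ftrlObjective Γ η A W' + β * (W' a b - W a b) := by
  linarith [hW.add_sq_le hΓ hW' a b, sq_nonneg ((W' a b - W a b) / 4 + 2 * β)]

theorem existsUnique_isFTRL (hΓ : IsRegularizer Γ) (η : ℝ) (A : Matrix (V ⊕ V) (V ⊕ V) ℝ)
    (hne : (decisionSet Γ Dhat).Nonempty) : ∃! W, IsFTRL Γ Dhat η A W := by
  have hcont : ContinuousOn (ftrlObjective Γ η A) (decisionSet Γ Dhat) := by
    unfold ftrlObjective frob
    refine ContinuousOn.add (ContinuousOn.neg (ContinuousOn.log (by fun_prop) ?_)) (by fun_prop)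
    exact fun W hW => (posDef_add_one
      (posSemidef_mul_mul_of_isHermitian hΓ.isHermitian hW.1)).det_pos.ne'
  obtain ⟨W, hW, hmin⟩ := (isCompact_decisionSet Γ Dhat).exists_isMinOn hne hcont
  have hWF : IsFTRL Γ Dhat η A W := ⟨hW, fun W' h => hmin h⟩
  refine ⟨W, hWF, fun W' hW' => ?_⟩
  ext a b
  have hsq : (W a b - W' a b) ^ 2 ≤ 0 := by
    linarith [hWF.add_sq_le hΓ hW'.1 a b, hW'.2 W hW]
  linarith [pow_eq_zero_iff two_ne_zero |>.mp (hsq.antisymm (sq_nonneg _))]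

end DecisionSet

/-! ### The regret bound -/

section Regret

theorem hinge_eq_max {γ : ℝ} (hγ : 0 < γ) (x : ℝ) : hinge γ x = max 0 (1 - x / γ) := by
  unfold hinge
  split_ifs with h
  · rw [max_eq_left (sub_nonpos.mpr ((one_le_div hγ).mpr h))]
  · rw [max_eq_right (sub_nonneg.mpr ((div_le_one hγ).mpr (not_le.mp h).le))]

theorem hinge_nonneg {γ : ℝ} (hγ : 0 < γ) (x : ℝ) : 0 ≤ hinge γ x :=
  hinge_eq_max hγ x ▸ le_max_left _ _

theorem one_sub_div_le_hinge {γ : ℝ} (hγ : 0 < γ) (x : ℝ) : 1 - x / γ ≤ hinge γ x :=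
  hinge_eq_max hγ x ▸ le_max_right _ _

theorem continuous_hinge {γ : ℝ} (hγ : 0 < γ) : Continuous (hinge γ) := by
  simp only [funext (hinge_eq_max hγ)]
  fun_prop

theorem hingeLoss_nonneg {V : Type*} {γ : ℝ} (hγ : 0 < γ) (T : ℕ) (i j : ℕ → V) (lab : ℕ → ℝ)
    (X : Matrix V V ℝ) : 0 ≤ hingeLoss γ T i j lab X :=
  Finset.sum_nonneg fun _ _ => hinge_nonneg hγ _

theorem mistakes_succ_of_eq {t : ℕ} {lab yhat : ℕ → ℝ} (h : yhat t = lab t) :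
    mistakes (t + 1) lab yhat = mistakes t lab yhat := by
  simp [mistakes, Finset.card_filter, Finset.sum_range_succ, h]

theorem mistakes_succ_of_ne {t : ℕ} {lab yhat : ℕ → ℝ} (h : yhat t ≠ lab t) :
    mistakes (t + 1) lab yhat = mistakes t lab yhat + 1 := by
  simp [mistakes, Finset.card_filter, Finset.sum_range_succ, h]

theorem label_mul_apply_le_one {ι : Type*} [Finite ι] {W : Matrix ι ι ℝ} (hW : W.PosSemidef)
    (hd : ∀ v, W v v ≤ 1) {l : ℝ} (hl : l = 1 ∨ l = -1) (a b : ι) : l * W a b ≤ 1 := by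
  have hW1 := abs_le.mp (abs_apply_le_one_of_posSemidef hW hd a b)
  rcases hl with rfl | rfl <;> linarith

variable {V : Type*} [DecidableEq V]

theorem lossMatrix_of_eq {γ : ℝ} {i j : ℕ → V} {lab yhat : ℕ → ℝ} {t : ℕ}
    (h : yhat t = lab t) : lossMatrix γ i j lab yhat t = 0 :=
  if_neg (not_not.mpr h)

theorem lossMatrix_of_ne {γ : ℝ} {i j : ℕ → V} {lab yhat : ℕ → ℝ} {t : ℕ}
    (h : yhat t ≠ lab t) :
    lossMatrix γ i j lab yhat t = (-(lab t) / γ) • sparseZ (i t) (j t) :=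
  if_pos h

theorem sum_lossMatrix_eq_zero {γ : ℝ} {i j : ℕ → V} {lab yhat : ℕ → ℝ} {t : ℕ}
    (h : mistakes t lab yhat = 0) :
    ∑ s ∈ Finset.range t, lossMatrix γ i j lab yhat s = 0 := by
  refine Finset.sum_eq_zero fun s hs => lossMatrix_of_eq ?_
  simpa using Finset.filter_eq_empty_iff.mp (Finset.card_eq_zero.mp h) hs

variable [Fintype V]

theorem frob_sparseZ {W : Matrix (V ⊕ V) (V ⊕ V) ℝ} (hW : W.IsHermitian) (i j : V) :
    frob W (sparseZ i j) = W (Sum.inl i) (Sum.inr j) := by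
  have hswap : W (Sum.inr j) (Sum.inl i) = W (Sum.inl i) (Sum.inr j) := by
    simpa using hW.apply (Sum.inl i) (Sum.inr j)
  have hWt : Wᵀ = W := by simpa using hW.eq
  simp only [frob, hWt, sparseZ, mul_smul_comm, Matrix.mul_add, trace_smul, trace_add, smul_eq_mul,
    trace_mul_single, hswap, MulOpposite.op_one, one_smul]
  ring

theorem frob_lossMatrix_of_ne {W : Matrix (V ⊕ V) (V ⊕ V) ℝ} (hW : W.IsHermitian) (γ : ℝ)
    (i j : ℕ → V) {lab yhat : ℕ → ℝ} {t : ℕ} (h : yhat t ≠ lab t) :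
    frob W (lossMatrix γ i j lab yhat t) =
      -(lab t * W (Sum.inl (i t)) (Sum.inr (j t)) / γ) := by
  rw [lossMatrix_of_ne h, ← frob_sparseZ hW]
  simp only [frob, mul_smul_comm, trace_smul, smul_eq_mul]
  ring

theorem frob_sum_lossMatrix_le {γ : ℝ} (hγ : 0 < γ) {W : Matrix (V ⊕ V) (V ⊕ V) ℝ}
    (hW : W.IsHermitian) (T : ℕ) (i j : ℕ → V) (lab yhat : ℕ → ℝ) :
    frob W (∑ s ∈ Finset.range T, lossMatrix γ i j lab yhat s) ≤
      hingeLoss γ T i j lab W.toBlocks₁₂ - mistakes T lab yhat := by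
  induction T with
  | zero => simp [frob, hingeLoss, mistakes]
  | succ t ih =>
    have hloss : hingeLoss γ (t + 1) i j lab W.toBlocks₁₂ = hingeLoss γ t i j lab W.toBlocks₁₂ +
        hinge γ (lab t * W (Sum.inl (i t)) (Sum.inr (j t))) := Finset.sum_range_succ _ _
    rw [Finset.sum_range_succ, frob_add_right, hloss]
    by_cases h : yhat t = lab t
    · rw [lossMatrix_of_eq h, mistakes_succ_of_eq h]
      simp only [frob, Matrix.mul_zero, trace_zero] at ih ⊢
      linarith [hinge_nonneg hγ (lab t * W (Sum.inl (i t)) (Sum.inr (j t)))]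
    · rw [frob_lossMatrix_of_ne hW γ i j h, mistakes_succ_of_ne h]
      push_cast
      linarith [one_sub_div_le_hinge hγ (lab t * W (Sum.inl (i t)) (Sum.inr (j t)))]

theorem ftrlObjective_add (Γ : Matrix (V ⊕ V) (V ⊕ V) ℝ) (η : ℝ)
    (A B W : Matrix (V ⊕ V) (V ⊕ V) ℝ) :
    ftrlObjective Γ η (A + B) W = ftrlObjective Γ η A W + η * frob W B := by
  simp only [ftrlObjective, frob_add_right]
  ring

theorem ftrlObjective_zero (Γ : Matrix (V ⊕ V) (V ⊕ V) ℝ) (η : ℝ) (W : Matrix (V ⊕ V) (V ⊕ V) ℝ) :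
    ftrlObjective Γ η 0 W = -Real.log (Γ * W * Γ + 1).det := by
  simp [ftrlObjective, frob]

theorem neg_le_ftrlObjective_zero {Γ : Matrix (V ⊕ V) (V ⊕ V) ℝ} (hΓ : Γ.IsHermitian)
    {Dhat : ℝ} (η : ℝ) {W : Matrix (V ⊕ V) (V ⊕ V) ℝ} (hW : W ∈ decisionSet Γ Dhat) :
    -Dhat ≤ ftrlObjective Γ η 0 W := by
  rw [ftrlObjective_zero, neg_le_neg_iff]
  exact (log_det_add_one_le_trace (posSemidef_mul_mul_of_isHermitian hΓ hW.1)).trans hW.2.2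

namespace IsRun

variable {Γ : Matrix (V ⊕ V) (V ⊕ V) ℝ} {γ Dhat η : ℝ} {T : ℕ} {i j : ℕ → V}
  {lab yhat : ℕ → ℝ} {W : ℕ → Matrix (V ⊕ V) (V ⊕ V) ℝ}

theorem isFTRL_of_mistakes_ne_zero (hrun : IsRun Γ γ Dhat η T i j lab W yhat) {t : ℕ}
    (ht : t ≤ T) (hm : mistakes t lab yhat ≠ 0) :
    IsFTRL Γ Dhat η (∑ s ∈ Finset.range t, lossMatrix γ i j lab yhat s) (W t) := by
  induction t with
  | zero => simp [mistakes] at hm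
  | succ t ih =>
    by_cases h : yhat t = lab t
    · rw [mistakes_succ_of_eq h] at hm
      rw [Finset.sum_range_succ, lossMatrix_of_eq h, add_zero, hrun.keep t ht h]
      exact ih (Nat.le_of_succ_le ht) hm
    · exact hrun.update t ht h

theorem label_mul_nonpos (hrun : IsRun Γ γ Dhat η T i j lab W yhat) {t : ℕ} (ht : t < T)
    (hW : (W t).IsHermitian) (hlab : lab t = 1 ∨ lab t = -1) (h : yhat t ≠ lab t) :
    lab t * W t (Sum.inl (i t)) (Sum.inr (j t)) ≤ 0 := by
  have hpos := hrun.pred_pos t ht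
  have hneg := hrun.pred_neg t ht
  rw [frob_sparseZ hW] at hpos hneg
  by_contra! hprod
  rcases hlab with hl | hl <;> rw [hl] at h hprod
  · exact h (hpos (by linarith))
  · exact h (hneg (by linarith))

theorem neg_le_ftrlObjective (hΓ : IsRegularizer Γ) (hγ : 0 < γ) (hη : 0 < η)
    (hlab : ∀ t < T, lab t = 1 ∨ lab t = -1) (hrun : IsRun Γ γ Dhat η T i j lab W yhat)
    {t : ℕ} (ht : t ≤ T) {Z : Matrix (V ⊕ V) (V ⊕ V) ℝ} (hZ : Z ∈ decisionSet Γ Dhat) :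
    -Dhat - η / γ - 4 * (η / γ) ^ 2 * mistakes t lab yhat ≤
      ftrlObjective Γ η (∑ s ∈ Finset.range t, lossMatrix γ i j lab yhat s) Z := by
  have hηγ : 0 < η / γ := div_pos hη hγ
  induction t generalizing Z with
  | zero =>
    have hm : mistakes 0 lab yhat = 0 := by simp [mistakes]
    rw [Finset.sum_range_zero, hm, Nat.cast_zero, mul_zero, sub_zero]
    linarith [neg_le_ftrlObjective_zero hΓ.isHermitian η hZ]
  | succ t ih =>
    by_cases h : yhat t = lab t
    · rw [Finset.sum_range_succ, lossMatrix_of_eq h, add_zero, mistakes_succ_of_eq h]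
      exact ih (Nat.le_of_succ_le ht) hZ
    rw [Finset.sum_range_succ, ftrlObjective_add, frob_lossMatrix_of_ne hZ.1.1 γ i j h,
      mistakes_succ_of_ne h]
    push_cast
    set z := Z (Sum.inl (i t)) (Sum.inr (j t))
    have hscale : η * -(lab t * z / γ) = -(η / γ * (lab t * z)) := by ring
    rw [hscale]
    rcases eq_or_ne (mistakes t lab yhat) 0 with hm | hm
    · rw [sum_lossMatrix_eq_zero hm, hm]
      have hz := mul_le_of_le_one_right hηγ.le (label_mul_apply_le_one hZ.1 hZ.2.1 (hlab t ht)
        (Sum.inl (i t)) (Sum.inr (j t)))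
      push_cast
      linarith [neg_le_ftrlObjective_zero hΓ.isHermitian η hZ, sq_nonneg (η / γ)]
    · have hF := hrun.isFTRL_of_mistakes_ne_zero (Nat.le_of_succ_le ht) hm
      have hstable := hF.sub_sq_le hΓ hZ (-(η / γ * lab t)) (Sum.inl (i t)) (Sum.inr (j t))
      have hw := mul_nonpos_of_nonneg_of_nonpos hηγ.le
        (hrun.label_mul_nonpos ht hF.1.1.1 (hlab t ht) h)
      have hl : lab t ^ 2 = 1 := by rcases hlab t ht with hl | hl <;> rw [hl] <;> norm_num
      have hsq : (-(η / γ * lab t)) ^ 2 = (η / γ) ^ 2 := by rw [neg_sq, mul_pow, hl, mul_one]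
      rw [hsq] at hstable
      linarith [ih (Nat.le_of_succ_le ht) hF.1]

theorem mistakes_le (hΓ : IsRegularizer Γ) (hγ : 0 < γ) (hη : 0 < η)
    (hlab : ∀ t < T, lab t = 1 ∨ lab t = -1) (hrun : IsRun Γ γ Dhat η T i j lab W yhat)
    {Z : Matrix (V ⊕ V) (V ⊕ V) ℝ} (hZ : Z ∈ decisionSet Γ Dhat) :
    (1 - 4 * (η / γ ^ 2)) * mistakes T lab yhat ≤
      hingeLoss γ T i j lab Z.toBlocks₁₂ + Dhat / η + 1 / γ := by
  have hlower := hrun.neg_le_ftrlObjective hΓ hγ hη hlab le_rfl hZ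
  have hlogdet := log_det_add_one_nonneg (posSemidef_mul_mul_of_isHermitian hΓ.isHermitian hZ.1)
  have hloss := mul_le_mul_of_nonneg_left (frob_sum_lossMatrix_le hγ hZ.1.1 T i j lab yhat) hη.le
  rw [ftrlObjective] at hlower
  refine le_of_mul_le_mul_left ?_ hη
  calc η * ((1 - 4 * (η / γ ^ 2)) * mistakes T lab yhat)
      = η * mistakes T lab yhat - 4 * (η / γ) ^ 2 * mistakes T lab yhat := by ring
    _ ≤ η * hingeLoss γ T i j lab Z.toBlocks₁₂ + Dhat + η / γ := by linarith
    _ = η * (hingeLoss γ T i j lab Z.toBlocks₁₂ + Dhat / η + 1 / γ) := by field_simp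

end IsRun

end Regret

/-! ### Side information and comparators -/

section SideInformation

variable {V : Type*} [Fintype V] [DecidableEq V] {M N : Matrix V V ℝ}

theorem pinv_eq_inv {A : Matrix V V ℝ} (hA : A.IsHermitian) (hu : IsUnit A.det) :
    pinv A = A⁻¹ := by
  calc pinv A = A⁻¹ * A * pinv A * (A * A⁻¹) := by
        rw [mul_nonsing_inv _ hu, nonsing_inv_mul _ hu, Matrix.one_mul, Matrix.mul_one]
    _ = A⁻¹ * (A * pinv A * A) * A⁻¹ := by simp only [Matrix.mul_assoc]
    _ = A⁻¹ := by rw [(pinv_penrose A hA).1, nonsing_inv_mul _ hu, Matrix.one_mul]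

theorem posSemidef_pinv (hM : M.PosSemidef) : (pinv M).PosSemidef := by
  have hpinv : (pinv M).IsHermitian := (cfc_predicate _ M : IsSelfAdjoint _)
  rw [← (pinv_penrose M hM.1).2.1]
  exact posSemidef_mul_mul_of_isHermitian hpinv hM

theorem pinv_apply_le_sqRadius (A : Matrix V V ℝ) (i : V) : pinv A i i ≤ sqRadius A :=
  le_ciSup (f := fun i => pinv A i i) (Set.finite_range _).bddAbove i

theorem sqRadius_nonneg (hM : M.PosSemidef) : 0 ≤ sqRadius M :=
  Real.iSup_nonneg fun _ => (posSemidef_pinv hM).diag_nonneg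

theorem sqRadius_pos [Nonempty V] (hM : M.PosDef) : 0 < sqRadius M := by
  obtain ⟨i⟩ := ‹Nonempty V›
  refine lt_of_lt_of_le ?_ (pinv_apply_le_sqRadius M i)
  rw [pinv_eq_inv hM.1 hM.det_pos.ne'.isUnit]
  exact hM.inv.diag_pos

theorem isHermitian_sideGamma (hM : M.PosSemidef) (hN : N.PosSemidef) :
    (sideGamma M N).IsHermitian :=
  IsHermitian.fromBlocks (msqrt_mul_self _ (hM.smul (sqRadius_nonneg hM))).1 (by simp)
    (msqrt_mul_self _ (hN.smul (sqRadius_nonneg hN))).1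

theorem sideGamma_mul_self (hM : M.PosSemidef) (hN : N.PosSemidef) :
    sideGamma M N * sideGamma M N = fromBlocks (sqRadius M • M) 0 0 (sqRadius N • N) := by
  simp [sideGamma, fromBlocks_multiply, (msqrt_mul_self _ (hM.smul (sqRadius_nonneg hM))).2,
    (msqrt_mul_self _ (hN.smul (sqRadius_nonneg hN))).2]

theorem isRegularizer_of_mul_self_mul_eq_one {Γ B : Matrix V V ℝ} (hΓ : Γ.IsHermitian)
    (hB : Γ * Γ * B = 1) (hdiag : ∀ v, B v v ≤ 1) : IsRegularizer Γ := by
  refine ⟨hΓ, fun v => ⟨Γ *ᵥ B *ᵥ Pi.single v 1, ?_, ?_⟩⟩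
  · rw [mulVec_mulVec, mulVec_mulVec, hB, one_mulVec]
  · rw [← dotProduct_mul_self_mulVec hΓ, mulVec_mulVec, hB, one_mulVec, mulVec_single_one,
      dotProduct_single_one]
    exact hdiag v

theorem isRegularizer_sideGamma [Nonempty V] (hM : M.PosDef) (hN : N.PosDef) :
    IsRegularizer (sideGamma M N) := by
  have hinv : ∀ {A : Matrix V V ℝ}, A.PosDef →
      (sqRadius A • A) * ((sqRadius A)⁻¹ • A⁻¹) = 1 := fun {A} hA => by
    rw [smul_mul_smul_comm, mul_inv_cancel₀ (sqRadius_pos hA).ne',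
      mul_nonsing_inv _ hA.det_pos.ne'.isUnit, one_smul]
  have hdiag : ∀ {A : Matrix V V ℝ}, A.PosDef → ∀ i, (sqRadius A)⁻¹ * A⁻¹ i i ≤ 1 :=
    fun {A} hA i => by
      rw [inv_mul_le_one₀ (sqRadius_pos hA), ← pinv_eq_inv hA.1 hA.det_pos.ne'.isUnit]
      exact pinv_apply_le_sqRadius A i
  refine isRegularizer_of_mul_self_mul_eq_one
    (B := fromBlocks ((sqRadius M)⁻¹ • M⁻¹) 0 0 ((sqRadius N)⁻¹ • N⁻¹))
    (isHermitian_sideGamma hM.posSemidef hN.posSemidef) ?_ ?_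
  · simp [sideGamma_mul_self hM.posSemidef hN.posSemidef, fromBlocks_multiply, hinv hM, hinv hN]
  · rintro (i | i)
    · exact hdiag hM i
    · exact hdiag hN i

end SideInformation

section Gram

theorem trace_fromBlocks_eq_add {m n : Type*} [Fintype m] [Fintype n] (A : Matrix m m ℝ)
    (B : Matrix m n ℝ) (C : Matrix n m ℝ) (D : Matrix n n ℝ) :
    (fromBlocks A B C D).trace = A.trace + D.trace := by
  simp [Matrix.trace]

theorem continuous_toBlocks₁₂ {m n : Type*} :
    Continuous (toBlocks₁₂ : Matrix (m ⊕ n) (m ⊕ n) ℝ → Matrix m n ℝ) :=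
  continuous_id.matrix_submatrix _ _

variable {V : Type*} {d : ℕ}

theorem fromRows_mul_transpose (P Q : Matrix V (Fin d) ℝ) :
    fromRows P Q * (fromRows P Q)ᵀ = fromBlocks (P * Pᵀ) (P * Qᵀ) (Q * Pᵀ) (Q * Qᵀ) := by
  rw [transpose_fromRows, fromRows_mul_fromCols]

theorem RowNormalized.abs_mul_transpose_apply_le_one {P Q : Matrix V (Fin d) ℝ}
    (hP : RowNormalized P) (hQ : RowNormalized Q) (i j : V) : |(P * Qᵀ) i j| ≤ 1 := by
  have hone : ∀ {R : Matrix V (Fin d) ℝ}, RowNormalized R → ∀ v, R v ⬝ᵥ R v = 1 :=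
    fun hR v => by simpa only [dotProduct, ← sq] using hR v
  rw [← sq_le_one_iff_abs_le_one]
  exact (sq_dotProduct_le (P i) (Q j)).trans_eq (by rw [hone hP, hone hQ, one_mul])

theorem mem_elliptope_sum_iff [Finite V] {W : Matrix (V ⊕ V) (V ⊕ V) ℝ} :
    W ∈ elliptope (V ⊕ V) ↔ ∃ (d : ℕ) (P Q : Matrix V (Fin d) ℝ), RowNormalized P ∧
      RowNormalized Q ∧ fromRows P Q * (fromRows P Q)ᵀ = W := by
  classical
  cases nonempty_fintype V
  constructor
  · rintro ⟨hW, hdiag⟩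
    obtain ⟨hS, hSS⟩ := msqrt_mul_self W hW
    have hSt : (msqrt W)ᵀ = msqrt W := by simpa using hS.eq
    let e := Fintype.equivFin (V ⊕ V)
    set B := (msqrt W).submatrix id e.symm with hB
    have hBW : B * Bᵀ = W := by
      rw [hB, transpose_submatrix, submatrix_mul_equiv, hSt, hSS, submatrix_id_id]
    have hrow : ∀ v, ∑ a, B v a ^ 2 = 1 := fun v => by
      rw [← hdiag v, ← hBW]
      simp [mul_apply, sq]
    exact ⟨_, B.toRows₁, B.toRows₂, fun i => hrow (Sum.inl i), fun i => hrow (Sum.inr i),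
      by rw [fromRows_toRows, hBW]⟩
  · rintro ⟨d, P, Q, hP, hQ, rfl⟩
    refine ⟨by simpa using posSemidef_self_mul_conjTranspose (fromRows P Q), ?_⟩
    rintro (i | i)
    · simpa [mul_apply, sq] using hP i
    · simpa [mul_apply, sq] using hQ i

variable [Fintype V] [DecidableEq V] {M N : Matrix V V ℝ}

theorem trace_sideGamma_mul_mul (hM : M.PosSemidef) (hN : N.PosSemidef)
    (P Q : Matrix V (Fin d) ℝ) :
    (sideGamma M N * (fromRows P Q * (fromRows P Q)ᵀ) * sideGamma M N).trace =
      sideCost M N P Q := by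
  rw [trace_mul_cycle, sideGamma_mul_self hM hN, fromRows_mul_transpose, fromBlocks_multiply,
    trace_fromBlocks_eq_add, sideCost, Matrix.zero_mul, Matrix.zero_mul, add_zero, zero_add,
    smul_mul_assoc, smul_mul_assoc, trace_smul, trace_smul, smul_eq_mul, smul_eq_mul,
    ← Matrix.mul_assoc, ← Matrix.mul_assoc, trace_mul_cycle, trace_mul_cycle N Q]

theorem comparators_eq_image (hM : M.PosSemidef) (hN : N.PosSemidef) (Dhat : ℝ) :
    comparators M N Dhat = toBlocks₁₂ ''
      {W ∈ elliptope (V ⊕ V) | (sideGamma M N * W * sideGamma M N).trace ≤ Dhat} := by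
  ext X
  constructor
  · rintro ⟨d, P, Q, hP, hQ, hcost, rfl⟩
    refine ⟨_, ⟨mem_elliptope_sum_iff.mpr ⟨d, P, Q, hP, hQ, rfl⟩, ?_⟩, ?_⟩
    · rwa [trace_sideGamma_mul_mul hM hN]
    · rw [fromRows_mul_transpose, toBlocks_fromBlocks₁₂]
  · rintro ⟨W, ⟨hW, hcost⟩, rfl⟩
    obtain ⟨d, P, Q, hP, hQ, rfl⟩ := mem_elliptope_sum_iff.mp hW
    rw [trace_sideGamma_mul_mul hM hN] at hcost
    exact ⟨d, P, Q, hP, hQ, hcost, by rw [fromRows_mul_transpose, toBlocks_fromBlocks₁₂]⟩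

theorem quasiDimValues_eq_image (hM : M.PosSemidef) (hN : N.PosSemidef) (γ : ℝ)
    (U : Matrix V V ℝ) :
    quasiDimValues γ M N U = (fun W => (sideGamma M N * W * sideGamma M N).trace) ''
      {W ∈ elliptope (V ⊕ V) | W.toBlocks₁₂ = γ • U} := by
  ext r
  constructor
  · rintro ⟨d, P, Q, hP, hQ, hPQ, rfl⟩
    refine ⟨_, ⟨mem_elliptope_sum_iff.mpr ⟨d, P, Q, hP, hQ, rfl⟩, ?_⟩,
      trace_sideGamma_mul_mul hM hN P Q⟩
    rw [fromRows_mul_transpose, toBlocks_fromBlocks₁₂, hPQ]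
  · rintro ⟨W, ⟨hW, hWU⟩, rfl⟩
    obtain ⟨d, P, Q, hP, hQ, rfl⟩ := mem_elliptope_sum_iff.mp hW
    rw [fromRows_mul_transpose, toBlocks_fromBlocks₁₂] at hWU
    exact ⟨d, P, Q, hP, hQ, hWU, trace_sideGamma_mul_mul hM hN P Q⟩

theorem quasiDim_mem_quasiDimValues (hM : M.PosSemidef) (hN : N.PosSemidef) {γ : ℝ}
    {U : Matrix V V ℝ} (hne : (quasiDimValues γ M N U).Nonempty) :
    quasiDim γ M N U ∈ quasiDimValues γ M N U := by
  refine IsCompact.sInf_mem ?_ hne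
  rw [quasiDimValues_eq_image hM hN]
  exact (isCompact_elliptope.inter_right
    (isClosed_eq continuous_toBlocks₁₂ continuous_const)).image (by fun_prop)

theorem smul_mem_comparators_of_quasiDim_le (hM : M.PosSemidef) (hN : N.PosSemidef)
    {γ Dhat : ℝ} {U : Matrix V V ℝ} (hne : (quasiDimValues γ M N U).Nonempty)
    (hD : quasiDim γ M N U ≤ Dhat) : γ • U ∈ comparators M N Dhat := by
  obtain ⟨d, P, Q, hP, hQ, hPQ, hcost⟩ := quasiDim_mem_quasiDimValues hM hN hne
  exact ⟨d, P, Q, hP, hQ, hcost ▸ hD, hPQ.symm⟩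

theorem margin_le_one {γ : ℝ} (hγ : 0 < γ) {U : Matrix V V ℝ} {i j : V}
    (hU : U i j = 1 ∨ U i j = -1) (hne : (quasiDimValues γ M N U).Nonempty) : γ ≤ 1 := by
  obtain ⟨_, d, P, Q, hP, hQ, hPQ, -⟩ := hne
  have h := hP.abs_mul_transpose_apply_le_one hQ i j
  rw [hPQ, Matrix.smul_apply, smul_eq_mul] at h
  rcases hU with hU | hU <;> simpa [hU, abs_of_pos hγ] using h

theorem minHingeLoss_mem (hM : M.PosSemidef) (hN : N.PosSemidef) {γ Dhat : ℝ} (hγ : 0 < γ)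
    (hne : (comparators M N Dhat).Nonempty) (T : ℕ) (i j : ℕ → V) (lab : ℕ → ℝ) :
    minHingeLoss γ M N Dhat T i j lab ∈ hingeLoss γ T i j lab '' comparators M N Dhat := by
  refine IsCompact.sInf_mem ?_ (hne.image _)
  have htrace : Continuous fun W : Matrix (V ⊕ V) (V ⊕ V) ℝ =>
      (sideGamma M N * W * sideGamma M N).trace := by fun_prop
  have hloss : Continuous (hingeLoss γ T i j lab) := by
    have := continuous_hinge hγ
    unfold hingeLoss
    fun_prop
  rw [comparators_eq_image hM hN]
  exact ((isCompact_elliptope.inter_right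
    (isClosed_le htrace continuous_const)).image continuous_toBlocks₁₂).image hloss

theorem exists_mem_decisionSet_of_mem_comparators (hM : M.PosSemidef) (hN : N.PosSemidef)
    {Dhat : ℝ} {X : Matrix V V ℝ} (hX : X ∈ comparators M N Dhat) :
    ∃ W ∈ decisionSet (sideGamma M N) Dhat, (∀ v, W v v = 1) ∧ W.toBlocks₁₂ = X := by
  rw [comparators_eq_image hM hN] at hX
  obtain ⟨W, ⟨hW, hcost⟩, hWX⟩ := hX
  exact ⟨W, ⟨hW.1, fun v => (hW.2 v).le, hcost⟩, hW.2, hWX⟩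

end Gram

/-! ### The mistake bound -/

section MistakeBound

theorem le_two_mul_add_of_one_sub_mul_le {c δ m H A : ℝ} (hc : 0 ≤ c) (hc8 : c ≤ 1 / 8)
    (hcδ : 8 * c ≤ δ) (hm : 0 ≤ m) (hH : 0 ≤ H) (hA : 0 ≤ A) (h : (1 - 4 * c) * m ≤ H + A) :
    m ≤ 2 * A + (1 + δ) * H := by
  have hone : 1 ≤ (1 + 8 * c) * (1 - 4 * c) := by nlinarith
  calc m ≤ (1 + 8 * c) * (1 - 4 * c) * m := le_mul_of_one_le_left hm hone
    _ ≤ (1 + 8 * c) * (H + A) := by rw [mul_assoc]; gcongr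
    _ = (1 + 8 * c) * A + (1 + 8 * c) * H := by ring
    _ ≤ 2 * A + (1 + δ) * H := by gcongr; linarith

variable {V : Type*}

theorem hingeLoss_smul_eq_zero {γ : ℝ} {T : ℕ} {i j : ℕ → V} {lab : ℕ → ℝ} {U : Matrix V V ℝ}
    (hlab : ∀ t < T, lab t = 1 ∨ lab t = -1) (hU : ∀ t < T, lab t = U (i t) (j t)) :
    hingeLoss γ T i j lab (γ • U) = 0 := by
  refine Finset.sum_eq_zero fun t ht => if_pos ?_
  rw [Finset.mem_range] at ht
  rw [Matrix.smul_apply, smul_eq_mul, ← hU t ht]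
  rcases hlab t ht with h | h <;> simp [h]

variable [Fintype V] [DecidableEq V] {M N : Matrix V V ℝ} {γ Dhat c δ : ℝ}

theorem minHingeLoss_nonneg (hγ : 0 < γ) (M N : Matrix V V ℝ) (Dhat : ℝ) (T : ℕ) (i j : ℕ → V)
    (lab : ℕ → ℝ) : 0 ≤ minHingeLoss γ M N Dhat T i j lab := by
  refine Real.sInf_nonneg ?_
  rintro _ ⟨X, -, rfl⟩
  exact hingeLoss_nonneg hγ T i j lab X

theorem IsRun.mistakes_le_of_mem_comparators {T : ℕ} {i j : ℕ → V} {lab yhat : ℕ → ℝ}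
    {W : ℕ → Matrix (V ⊕ V) (V ⊕ V) ℝ} {X : Matrix V V ℝ}
    (hrun : IsRun (sideGamma M N) γ Dhat (c * γ ^ 2) T i j lab W yhat)
    (hlab : ∀ t < T, lab t = 1 ∨ lab t = -1) (hM : M.PosDef) (hN : N.PosDef)
    (hγ : 0 < γ) (hγ1 : γ ≤ 1) (hc : 0 < c) (hc8 : c ≤ 1 / 8) (hcδ : 8 * c ≤ δ)
    (hX : X ∈ comparators M N Dhat) :
    (mistakes T lab yhat : ℝ) ≤
      2 * (1 / c + 1) * Dhat / γ ^ 2 + (1 + δ) * hingeLoss γ T i j lab X := by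
  have : Nonempty V := ⟨i 0⟩
  have hΓ := isRegularizer_sideGamma hM hN
  obtain ⟨Z, hZ, hdiag, rfl⟩ :=
    exists_mem_decisionSet_of_mem_comparators hM.posSemidef hN.posSemidef hX
  have hD : 1 ≤ Dhat := one_le_of_mem_decisionSet hΓ hZ (hdiag (Sum.inl (i 0)))
  have hregret := hrun.mistakes_le hΓ hγ (by positivity) hlab hZ
  have hηc : c * γ ^ 2 / γ ^ 2 = c := by field_simp
  have hmargin : 1 / γ ≤ Dhat / γ ^ 2 := by
    rw [div_le_div_iff₀ hγ (by positivity)]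
    nlinarith
  have hsum : Dhat / (c * γ ^ 2) + Dhat / γ ^ 2 = (1 / c + 1) * Dhat / γ ^ 2 := by field_simp
  rw [hηc] at hregret
  refine (le_two_mul_add_of_one_sub_mul_le (A := (1 / c + 1) * Dhat / γ ^ 2) hc.le hc8 hcδ
    (Nat.cast_nonneg _) (hingeLoss_nonneg hγ T i j lab Z.toBlocks₁₂) (by positivity) ?_).trans_eq ?_
  · linarith
  · ring

theorem mistakeBound_of_mem_comparators (hM : M.PosDef) (hγ : 0 < γ) (hγ1 : γ ≤ 1) (hc : 0 < c)
    (hc8 : c ≤ 1 / 8) (hcδ : 8 * c ≤ δ) {U : Matrix V V ℝ} (hU : γ • U ∈ comparators M M Dhat) :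
    MistakeBound M U γ Dhat (c * γ ^ 2) δ (2 * (1 / c + 1) * Dhat / γ ^ 2) := by
  intro T i j lab W yhat hlab hrun
  have hbound {X} (hX : X ∈ comparators M M Dhat) :=
    hrun.mistakes_le_of_mem_comparators hlab hM hM hγ hγ1 hc hc8 hcδ hX
  constructor
  · obtain ⟨X, hX, hmin⟩ :=
      minHingeLoss_mem hM.posSemidef hM.posSemidef hγ ⟨_, hU⟩ T i j lab
    exact hmin ▸ hbound hX
  · intro hlabU
    have h := hbound hU
    rw [hingeLoss_smul_eq_zero hlab hlabU, mul_zero] at h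
    exact h.trans (add_le_add_right (minHingeLoss_nonneg hγ M M Dhat T i j lab) _)

theorem MistakeBound.mono {U : Matrix V V ℝ} {η B B' : ℝ}
    (h : MistakeBound M U γ Dhat η δ B) (hB : B ≤ B') : MistakeBound M U γ Dhat η δ B' := by
  intro T i j lab W yhat hlab hrun
  obtain ⟨hany, hreal⟩ := h T i j lab W yhat hlab hrun
  exact ⟨by linarith, fun hU => by linarith [hreal hU]⟩

theorem mistakeBound_of_quasiDim_le (hM : M.PosDef) (hγ : 0 < γ) (hγ1 : γ ≤ 1) (hc : 0 < c)
    (hc8 : c ≤ 1 / 8) (hcδ : 8 * c ≤ δ) {U : Matrix V V ℝ}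
    (hne : (quasiDimValues γ M M U).Nonempty) (hD : quasiDim γ M M U ≤ Dhat) {Y : ℝ}
    (hY : Dhat ≤ 48 * Y) :
    MistakeBound M U γ Dhat (c * γ ^ 2) δ (96 * (1 / c + 1) * Y / γ ^ 2) := by
  refine (mistakeBound_of_mem_comparators hM hγ hγ1 hc hc8 hcδ
    (smul_mem_comparators_of_quasiDim_le hM.posSemidef hM.posSemidef hne hD)).mono ?_
  calc 2 * (1 / c + 1) * Dhat / γ ^ 2 ≤ 2 * (1 / c + 1) * (48 * Y) / γ ^ 2 := by gcongr
    _ = 96 * (1 / c + 1) * Y / γ ^ 2 := by ring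

end MistakeBound

/-! ### Graph Laplacian and effective resistance -/

section Pinv

variable {V : Type*} [Fintype V] [DecidableEq V]

theorem transpose_pinv (A : Matrix V V ℝ) : (pinv A)ᵀ = pinv A := by
  have h : IsSelfAdjoint (pinv A) := cfc_predicate _ A
  simpa [star_eq_conjTranspose] using h.star_eq

theorem pinv_apply_comm (A : Matrix V V ℝ) (i j : V) : pinv A i j = pinv A j i :=
  congrFun (congrFun (transpose_pinv A) j) i

theorem mul_pinv_comm {A : Matrix V V ℝ} (hA : A.IsHermitian) : A * pinv A = pinv A * A := by
  have hAt : Aᵀ = A := by simpa using hA.eq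
  rw [← (pinv_penrose A hA).2.2.1, transpose_mul, transpose_pinv, hAt]

end Pinv

section EdgeSums

variable {V : Type*} {G : SimpleGraph V}

/-- The squared difference of the values of `x` at the two ends of an edge: its contribution to
the Laplacian quadratic form. -/
def sqDiff (x : V → ℝ) : Sym2 V → ℝ :=
  Sym2.lift ⟨fun i j => (x i - x j) ^ 2, fun _ _ => sub_sq_comm _ _⟩

theorem sqDiff_mk (x : V → ℝ) (i j : V) : sqDiff x s(i, j) = (x i - x j) ^ 2 := rfl

theorem sqDiff_nonneg (x : V → ℝ) (e : Sym2 V) : 0 ≤ sqDiff x e := by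
  induction e with | h i j => exact sq_nonneg _

theorem two_mul_sub_length_le_sum_edges (x : V → ℝ) {u v : V} (p : G.Walk u v) :
    2 * (x u - x v) - p.length ≤ (p.edges.map (sqDiff x)).sum := by
  induction p with
  | nil => simp
  | @cons a b c h q ih =>
    rw [SimpleGraph.Walk.edges_cons, List.map_cons, List.sum_cons, sqDiff_mk,
      SimpleGraph.Walk.length_cons]
    push_cast
    linarith [sq_nonneg (x a - x b - 1)]

variable [Fintype V] [DecidableRel G.Adj]

theorem sum_sum_adj_eq_two_mul_sum_edgeFinset (f : Sym2 V → ℝ) :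
    (∑ i, ∑ j, if G.Adj i j then f s(i, j) else 0) = 2 * ∑ e ∈ G.edgeFinset, f e := by
  classical
  have hmaps : ∀ p ∈ ({p | G.Adj p.1 p.2} : Finset (V × V)), s(p.1, p.2) ∈ G.edgeFinset := by
    simp
  rw [← Fintype.sum_prod_type', ← Finset.sum_filter, ← Finset.sum_fiberwise_of_maps_to hmaps,
    Finset.mul_sum]
  refine Finset.sum_congr rfl fun e he => ?_
  induction e with | h a b
  have hab : G.Adj a b := by simpa using he
  have hfiber : ({p ∈ ({p | G.Adj p.1 p.2} : Finset (V × V)) | s(p.1, p.2) = s(a, b)}) =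
      {(a, b), (b, a)} := by
    ext ⟨c, d⟩
    simp only [Finset.mem_filter, Finset.mem_univ, true_and, Finset.mem_insert,
      Finset.mem_singleton, Prod.mk.injEq, Sym2.eq_iff, and_iff_right_iff_imp]
    rintro (⟨rfl, rfl⟩ | ⟨rfl, rfl⟩)
    exacts [hab, hab.symm]
  rw [hfiber, Finset.sum_pair (by simp [hab.ne]), Sym2.eq_swap, two_mul]

variable [DecidableEq V]

theorem dotProduct_lapMatrix_mulVec (x : V → ℝ) :
    x ⬝ᵥ G.lapMatrix ℝ *ᵥ x = ∑ e ∈ G.edgeFinset, sqDiff x e := by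
  have h := sum_sum_adj_eq_two_mul_sum_edgeFinset (G := G) (sqDiff x)
  simp only [sqDiff_mk] at h
  rw [← toLinearMap₂'_apply', G.lapMatrix_toLinearMap₂' ℝ, h, mul_div_cancel_left₀ _ two_ne_zero]

theorem trace_transpose_mul_lapMatrix_mul {κ : Type*} [Fintype κ] (P : Matrix V κ ℝ) :
    (Pᵀ * G.lapMatrix ℝ * P).trace = ∑ e ∈ G.edgeFinset, ∑ a, sqDiff (P.col a) e := by
  simp only [trace_transpose_mul_mul, dotProduct_lapMatrix_mulVec]
  exact Finset.sum_comm

theorem two_mul_sub_dist_le (hG : G.Connected) (x : V → ℝ) (u v : V) :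
    2 * (x u - x v) - G.dist u v ≤ x ⬝ᵥ G.lapMatrix ℝ *ᵥ x := by
  obtain ⟨p, hp, hlength⟩ := hG.exists_path_of_dist u v
  calc 2 * (x u - x v) - G.dist u v ≤ (p.edges.map (sqDiff x)).sum := by
        rw [← hlength]
        exact two_mul_sub_length_le_sum_edges x p
    _ = ∑ e ∈ p.edges.toFinset, sqDiff x e := (List.sum_toFinset _ hp.isTrail.edges_nodup).symm
    _ ≤ ∑ e ∈ G.edgeFinset, sqDiff x e :=
        Finset.sum_le_sum_of_subset_of_nonneg
          (fun e he => by simpa using p.edges_subset_edgeSet (List.mem_toFinset.mp he))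
          fun e _ _ => sqDiff_nonneg x e
    _ = x ⬝ᵥ G.lapMatrix ℝ *ᵥ x := (dotProduct_lapMatrix_mulVec x).symm

end EdgeSums

section Laplacian

variable {V : Type*} [Fintype V] [DecidableEq V] {G : SimpleGraph V} [DecidableRel G.Adj]

theorem pinv_lapMatrix_mulVec_one : pinv (G.lapMatrix ℝ) *ᵥ (fun _ => 1) = 0 := by
  have hL := G.isHermitian_lapMatrix ℝ
  rw [← (pinv_penrose _ hL).2.1, Matrix.mul_assoc, mul_pinv_comm hL, ← mulVec_mulVec,
    ← mulVec_mulVec, G.lapMatrix_mulVec_const_eq_zero, mulVec_zero, mulVec_zero]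

theorem apply_eq_of_lapMatrix_mul_eq_zero (hG : G.Connected) {κ : Type*} {E : Matrix V κ ℝ}
    (hE : G.lapMatrix ℝ * E = 0) (i i' : V) (a : κ) : E i a = E i' a := by
  have hcol : G.lapMatrix ℝ *ᵥ E.col a = 0 := funext fun v => congrFun (congrFun hE v) a
  exact G.lapMatrix_mulVec_eq_zero_iff_forall_reachable.mp hcol i i' (hG.preconnected i i')

theorem lapMatrix_mul_pinv (hG : G.Connected) :
    G.lapMatrix ℝ * pinv (G.lapMatrix ℝ) =
      1 - Matrix.of fun _ _ => (Fintype.card V : ℝ)⁻¹ := by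
  set L := G.lapMatrix ℝ with hL
  have hsymm : L.IsHermitian := G.isHermitian_lapMatrix ℝ
  rw [mul_pinv_comm hsymm, eq_sub_iff_add_eq, ← eq_sub_iff_add_eq']
  set E := 1 - pinv L * L with hE
  have hLE : L * E = 0 := by
    rw [hE, Matrix.mul_sub, ← Matrix.mul_assoc, (pinv_penrose L hsymm).1, Matrix.mul_one, sub_self]
  have hEt : Eᵀ = E := by
    rw [hE, transpose_sub, (pinv_penrose L hsymm).2.2.2, transpose_one]
  have hrow : ∀ i j j', E i j = E i j' := fun i j j' => by
    rw [← hEt]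
    exact apply_eq_of_lapMatrix_mul_eq_zero hG hLE j j' i
  have hone : E *ᵥ (fun _ => 1) = fun _ => 1 := by
    rw [hE, sub_mulVec, ← mulVec_mulVec, hL, G.lapMatrix_mulVec_const_eq_zero, mulVec_zero,
      sub_zero, one_mulVec]
  ext i j
  have hsum : ∑ j', E i j' = 1 := by simpa [mulVec, dotProduct] using congrFun hone i
  have hcard : (Fintype.card V : ℝ) * E i j = 1 := by
    simpa [Finset.sum_congr rfl fun j' _ => hrow i j' j] using hsum
  exact (eq_inv_of_mul_eq_one_right hcard).symm

theorem sqRadius_lapMatrix_pos [Nontrivial V] (hG : G.Connected) :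
    0 < sqRadius (G.lapMatrix ℝ) := by
  by_contra! hR
  have hpsd := posSemidef_pinv (G.posSemidef_lapMatrix ℝ)
  have hzero : pinv (G.lapMatrix ℝ) = 0 := by
    rw [← hpsd.trace_eq_zero_iff]
    exact le_antisymm
      (Finset.sum_nonpos fun i _ => (pinv_apply_le_sqRadius _ i).trans hR) hpsd.trace_nonneg
  obtain ⟨a, b, hab⟩ := exists_pair_ne V
  have hentry := congrFun (congrFun (lapMatrix_mul_pinv hG) a) b
  rw [hzero, Matrix.mul_zero, Matrix.sub_apply, one_apply_ne hab] at hentry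
  simp at hentry

theorem pdLaplacian_mul_pinv_add [Nontrivial V] (hG : G.Connected) :
    pdLaplacian G * (pinv (G.lapMatrix ℝ) +
      sqRadius (G.lapMatrix ℝ) • Matrix.of fun _ _ => (1 : ℝ)) = 1 := by
  set L := G.lapMatrix ℝ
  set R := sqRadius L
  set n := (Fintype.card V : ℝ) with hn
  set J : Matrix V V ℝ := Matrix.of fun _ _ => (1 : ℝ) with hJ
  have hR0 : R ≠ 0 := (sqRadius_lapMatrix_pos hG).ne'
  have hn0 : n ≠ 0 := Nat.cast_ne_zero.mpr Fintype.card_ne_zero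
  have hLP : L * pinv L = 1 - n⁻¹ • J := by
    rw [lapMatrix_mul_pinv hG]
    ext
    simp [hJ, hn]
  have hLJ : L * J = 0 :=
    Matrix.ext fun a _ => congrFun (G.lapMatrix_mulVec_const_eq_zero (R := ℝ)) a
  have hPJ : pinv L * J = 0 := Matrix.ext fun a _ => congrFun pinv_lapMatrix_mulVec_one a
  have hJP : J * pinv L = 0 := by
    simpa [transpose_pinv, show Jᵀ = J from rfl] using congrArg transpose hPJ
  have hJJ : J * J = n • J := by
    ext
    simp [hJ, hn, mul_apply]
  have hcoeff : R⁻¹ * (1 / n ^ 2) * R * n = n⁻¹ := by field_simp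
  rw [pdLaplacian, Matrix.add_mul, Matrix.mul_add, Matrix.mul_add, hLP, mul_smul_comm, hLJ,
    smul_mul_assoc, hJP, smul_mul_smul_comm, hJJ, smul_smul, hcoeff, smul_zero, smul_zero,
    add_zero, zero_add, sub_add_cancel]

theorem posDef_pdLaplacian [Nontrivial V] (hG : G.Connected) : (pdLaplacian G).PosDef := by
  have hR := sqRadius_lapMatrix_pos hG
  have hpsd : (pdLaplacian G).PosSemidef :=
    (G.posSemidef_lapMatrix ℝ).add ((posSemidef_of_const_one (ι := V)).smul (by positivity))
  rw [hpsd.posDef_iff_isUnit, isUnit_iff_isUnit_det]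
  exact isUnit_det_of_right_inverse (pdLaplacian_mul_pinv_add hG)

theorem sqRadius_pdLaplacian [Nontrivial V] (hG : G.Connected) :
    sqRadius (pdLaplacian G) = 2 * sqRadius (G.lapMatrix ℝ) := by
  have hpd := posDef_pdLaplacian hG
  calc sqRadius (pdLaplacian G)
      = ⨆ i, (pinv (G.lapMatrix ℝ) i i + sqRadius (G.lapMatrix ℝ)) := by
        rw [sqRadius, pinv_eq_inv hpd.1 hpd.det_pos.ne'.isUnit,
          inv_eq_right_inv (pdLaplacian_mul_pinv_add hG)]
        simp
    _ = 2 * sqRadius (G.lapMatrix ℝ) := by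
        rw [← ciSup_add (Set.finite_range _).bddAbove, two_mul]
        rfl

theorem effRes_eq (i j : V) : effRes G i j = pinv (G.lapMatrix ℝ) i i +
    pinv (G.lapMatrix ℝ) j j - 2 * pinv (G.lapMatrix ℝ) i j := by
  simp only [effRes, mulVec_sub, mulVec_single_one, dotProduct_sub, sub_dotProduct,
    single_one_dotProduct, col_apply, pinv_apply_comm _ j i]
  ring

theorem effRes_le_resDiam (i j : V) : effRes G i j ≤ resDiam G :=
  le_ciSup (f := fun p : V × V => effRes G p.1 p.2) (Set.finite_range _).bddAbove (i, j)

theorem sqRadius_le_resDiam [Nonempty V] : sqRadius (G.lapMatrix ℝ) ≤ resDiam G := by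
  set P := pinv (G.lapMatrix ℝ) with hP
  refine ciSup_le fun i => ?_
  have hcard : (0 : ℝ) < Fintype.card V := Nat.cast_pos.mpr Fintype.card_pos
  have hrow : ∑ j, P i j = 0 := by
    simpa [mulVec, dotProduct] using congrFun (pinv_lapMatrix_mulVec_one (G := G)) i
  have htrace : 0 ≤ ∑ j, P j j := (posSemidef_pinv (G.posSemidef_lapMatrix ℝ)).trace_nonneg
  refine le_of_mul_le_mul_left ?_ hcard
  calc (Fintype.card V : ℝ) * P i i ≤ Fintype.card V * P i i + ∑ j, P j j := by linarith
    _ = ∑ j, effRes G i j := by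
        simp only [effRes_eq, ← hP, Finset.sum_sub_distrib, Finset.sum_add_distrib,
          ← Finset.mul_sum, hrow, Finset.sum_const, Finset.card_univ, nsmul_eq_mul]
        ring
    _ ≤ Fintype.card V * resDiam G := by
        simpa using Finset.sum_le_card_nsmul Finset.univ (effRes G i) (resDiam G)
          fun j _ => effRes_le_resDiam i j

theorem effRes_le_four_mul_sqRadius (i j : V) :
    effRes G i j ≤ 4 * sqRadius (G.lapMatrix ℝ) := by
  have h := (posSemidef_pinv (G.posSemidef_lapMatrix ℝ)).dotProduct_mulVec_nonneg
    (Pi.single i 1 + Pi.single j 1)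
  simp only [star_trivial, mulVec_add, mulVec_single_one, dotProduct_add, add_dotProduct,
    single_one_dotProduct, col_apply, pinv_apply_comm _ j i] at h
  rw [effRes_eq]
  linarith [pinv_apply_le_sqRadius (G.lapMatrix ℝ) i, pinv_apply_le_sqRadius (G.lapMatrix ℝ) j]

theorem resDiam_le_four_mul_sqRadius [Nonempty V] :
    resDiam G ≤ 4 * sqRadius (G.lapMatrix ℝ) :=
  ciSup_le fun p => effRes_le_four_mul_sqRadius p.1 p.2

variable (G) in
/-- The potential of the unit current from `i` to `j`; its energy and its drop from `i` to `j` are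
both the effective resistance. -/
noncomputable def potential (i j : V) : V → ℝ :=
  pinv (G.lapMatrix ℝ) *ᵥ (Pi.single i 1 - Pi.single j 1)

theorem potential_sub_potential (i j : V) :
    potential G i j i - potential G i j j = effRes G i j := by
  simp [potential, effRes, sub_dotProduct]

theorem lapMatrix_mulVec_potential (hG : G.Connected) (i j : V) :
    G.lapMatrix ℝ *ᵥ potential G i j = Pi.single i 1 - Pi.single j 1 := by
  rw [potential, mulVec_mulVec, lapMatrix_mul_pinv hG, sub_mulVec, one_mulVec, sub_eq_self]
  ext
  simp [mulVec_sub]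

theorem dotProduct_lapMatrix_mulVec_potential (hG : G.Connected) (x : V → ℝ) (i j : V) :
    x ⬝ᵥ G.lapMatrix ℝ *ᵥ potential G i j = x i - x j := by
  rw [lapMatrix_mulVec_potential hG, dotProduct_sub, dotProduct_single_one, dotProduct_single_one]

theorem sq_sub_le_effRes_mul (hG : G.Connected) (x : V → ℝ) (i j : V) :
    (x i - x j) ^ 2 ≤ effRes G i j * (x ⬝ᵥ G.lapMatrix ℝ *ᵥ x) := by
  have h := sq_dotProduct_mulVec_le_of_posSemidef (G.posSemidef_lapMatrix ℝ) x (potential G i j)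
  rwa [dotProduct_lapMatrix_mulVec_potential hG, dotProduct_lapMatrix_mulVec_potential hG,
    potential_sub_potential, mul_comm] at h

theorem effRes_le_dist (hG : G.Connected) (i j : V) : effRes G i j ≤ G.dist i j := by
  have h := two_mul_sub_dist_le hG (potential G i j) i j
  rw [dotProduct_lapMatrix_mulVec_potential hG, potential_sub_potential] at h
  linarith

theorem resDiam_le_of_dist_le (hG : G.Connected) {d : ℕ} (hd : ∀ u v, G.dist u v ≤ d) :
    resDiam G ≤ d := by
  have := hG.nonempty
  exact ciSup_le fun p => (effRes_le_dist hG p.1 p.2).trans (Nat.cast_le.mpr (hd p.1 p.2))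

end Laplacian

/-! ### Labelled classes -/

section Classes

variable {V : Type*} {k d : ℕ} {y : V → Fin k}

theorem classMatrix_mul_mul_transpose_apply (y : V → Fin k) (A : Matrix (Fin k) (Fin k) ℝ)
    (i j : V) : (classMatrix y * A * (classMatrix y)ᵀ) i j = A (y i) (y j) := by
  simp [classMatrix, mul_apply]

/-- The inner products are `2γ - γ` inside a class and `0 - γ` across classes: `√(2γ) R` contributes
the first term and the columns `±√γ` the second; the last two columns normalise the rows. -/
theorem exists_rowNormalized_simMatrix (y : V → Fin k) {γ : ℝ} (hγ : 0 ≤ γ) (hγ' : γ ≤ 1 / 3) :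
    ∃ P Q : Matrix V (Fin (k + 3)) ℝ, RowNormalized P ∧ RowNormalized Q ∧
      P * Qᵀ = γ • simMatrix y := by
  set s := √(2 * γ)
  set b := √γ
  set z := √(1 - 3 * γ)
  have hs : s * s = 2 * γ := Real.mul_self_sqrt (by linarith)
  have hb : b * b = γ := Real.mul_self_sqrt hγ
  have hz : z * z = 1 - 3 * γ := Real.mul_self_sqrt (by linarith)
  refine ⟨(fromCols (s • classMatrix y) (of fun _ => ![b, z, 0])).submatrix id finSumFinEquiv.symm,
    (fromCols (s • classMatrix y) (of fun _ => ![-b, 0, z])).submatrix id finSumFinEquiv.symm,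
    fun i => ?_, fun i => ?_, ?_⟩
  · rw [← finSumFinEquiv.sum_comp]
    simp [Fintype.sum_sum_type, Fin.sum_univ_three, classMatrix, sq, hs, hb, hz]
    ring
  · rw [← finSumFinEquiv.sum_comp]
    simp [Fintype.sum_sum_type, Fin.sum_univ_three, classMatrix, sq, hs, hb, hz]
    ring
  · ext i j
    rw [mul_apply, ← finSumFinEquiv.sum_comp]
    by_cases hij : y i = y j
    · simp [Fintype.sum_sum_type, Fin.sum_univ_three, classMatrix, simMatrix, hs, hb, hij]
      ring
    · simp [Fintype.sum_sum_type, Fin.sum_univ_three, classMatrix, simMatrix, hb, hij]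

/-- Replace every row by the row of one fixed representative of its class. -/
theorem exists_factorization_factorsThrough {Ustar : Matrix (Fin k) (Fin k) ℝ} {γ : ℝ}
    {P Q : Matrix V (Fin d) ℝ} (hP : RowNormalized P) (hQ : RowNormalized Q)
    (hPQ : P * Qᵀ = γ • (classMatrix y * Ustar * (classMatrix y)ᵀ)) :
    ∃ P' Q' : Matrix V (Fin d) ℝ, RowNormalized P' ∧ RowNormalized Q' ∧
      P' * Q'ᵀ = γ • (classMatrix y * Ustar * (classMatrix y)ᵀ) ∧
      Function.FactorsThrough P' y ∧ Function.FactorsThrough Q' y := by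
  set ρ : V → V := fun i => Set.rangeSplitting y (Set.rangeFactorization y i)
  have hyρ : ∀ i, y (ρ i) = y i := fun i => Set.apply_rangeSplitting y _
  have hρ : ∀ i j, y i = y j → ρ i = ρ j := fun i j hij =>
    congrArg (Set.rangeSplitting y) (Subtype.ext hij)
  refine ⟨P.submatrix ρ id, Q.submatrix ρ id, fun i => hP (ρ i), fun i => hQ (ρ i), ?_,
    fun i j hij => ?_, fun i j hij => ?_⟩
  · ext i j
    have hentry := congrFun (congrFun hPQ (ρ i)) (ρ j)
    rw [Matrix.smul_apply, classMatrix_mul_mul_transpose_apply, hyρ, hyρ] at hentry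
    rw [Matrix.smul_apply, classMatrix_mul_mul_transpose_apply, ← hentry]
    simp [mul_apply]
  · exact congrArg P (hρ i j hij)
  · exact congrArg Q (hρ i j hij)

theorem sum_sqDiff_classMatrix_col (y : V → Fin k) (e : Sym2 V) :
    ∑ s, sqDiff ((classMatrix y).col s) e = if (e.map y).IsDiag then 0 else 2 := by
  induction e with | h i j
  simp only [sqDiff_mk, col_apply, classMatrix, of_apply, Sym2.map_mk, Sym2.mk_isDiag_iff]
  split_ifs with hij
  · simp [hij]
  · have hterm : ∀ s, ((if y i = s then 1 else 0) - (if y j = s then 1 else 0) : ℝ) ^ 2 =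
        (if y i = s then 1 else 0) + (if y j = s then 1 else 0) := by
      intro s
      split_ifs with hi hj
      · exact absurd (hi.trans hj.symm) hij
      all_goals norm_num
    simp only [hterm, Finset.sum_add_distrib, Finset.sum_ite_eq, Finset.mem_univ, if_true]
    norm_num

theorem RowNormalized.sum_sqDiff_col_le {P : Matrix V (Fin d) ℝ} (hP : RowNormalized P)
    (hPy : Function.FactorsThrough P y) (e : Sym2 V) :
    ∑ a, sqDiff (P.col a) e ≤ 2 * ∑ s, sqDiff ((classMatrix y).col s) e := by
  rw [sum_sqDiff_classMatrix_col]
  induction e with | h i j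
  simp only [sqDiff_mk, col_apply, Sym2.map_mk, Sym2.mk_isDiag_iff]
  split_ifs with hij
  · simp [hPy hij]
  · calc ∑ a, (P i a - P j a) ^ 2 ≤ ∑ a, (2 * P i a ^ 2 + 2 * P j a ^ 2) :=
          Finset.sum_le_sum fun a _ => by linarith [sq_nonneg (P i a + P j a)]
      _ = 2 * 2 := by
          rw [Finset.sum_add_distrib, ← Finset.mul_sum, ← Finset.mul_sum, hP i, hP j]
          norm_num

variable [Fintype V]

theorem RowNormalized.trace_transpose_mul_ones_mul_le {P : Matrix V (Fin d) ℝ}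
    (hP : RowNormalized P) :
    (Pᵀ * (of fun _ _ => (1 : ℝ) : Matrix V V ℝ) * P).trace ≤ (Fintype.card V : ℝ) ^ 2 := by
  calc (Pᵀ * (of fun _ _ => (1 : ℝ) : Matrix V V ℝ) * P).trace = ∑ a, (∑ i, P i a) ^ 2 := by
        rw [trace_transpose_mul_mul]
        simp [dotProduct, mulVec, sq, Finset.sum_mul]
    _ ≤ ∑ a, (Fintype.card V : ℝ) * ∑ i, P i a ^ 2 :=
        Finset.sum_le_sum fun _ _ => sq_sum_le_card_mul_sum_sq
    _ = (Fintype.card V : ℝ) ^ 2 := by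
        rw [← Finset.mul_sum, Finset.sum_comm, Finset.sum_congr rfl fun i _ => hP i]
        simp [sq]

variable [DecidableEq V] {M N : Matrix V V ℝ}

theorem sideCost_nonneg (hM : M.PosSemidef) (hN : N.PosSemidef) (P Q : Matrix V (Fin d) ℝ) :
    0 ≤ sideCost M N P Q :=
  add_nonneg (mul_nonneg (sqRadius_nonneg hM) (trace_transpose_mul_mul_nonneg hM P))
    (mul_nonneg (sqRadius_nonneg hN) (trace_transpose_mul_mul_nonneg hN Q))

theorem quasiDim_le_sideCost (hM : M.PosSemidef) (hN : N.PosSemidef) {γ : ℝ} {U : Matrix V V ℝ}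
    {P Q : Matrix V (Fin d) ℝ} (hP : RowNormalized P) (hQ : RowNormalized Q)
    (hPQ : P * Qᵀ = γ • U) : quasiDim γ M N U ≤ sideCost M N P Q := by
  refine csInf_le ⟨0, ?_⟩ ⟨d, P, Q, hP, hQ, hPQ, rfl⟩
  rintro _ ⟨d, P, Q, -, -, -, rfl⟩
  exact sideCost_nonneg hM hN P Q

theorem quasiDimValues_simMatrix_nonempty (M N : Matrix V V ℝ) (y : V → Fin k) {γ : ℝ}
    (hγ : 0 ≤ γ) (hγ' : γ ≤ 1 / 3) : (quasiDimValues γ M N (simMatrix y)).Nonempty := by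
  obtain ⟨P, Q, hP, hQ, hPQ⟩ := exists_rowNormalized_simMatrix y hγ hγ'
  exact ⟨_, _, P, Q, hP, hQ, hPQ, rfl⟩

variable {G : SimpleGraph V} [DecidableRel G.Adj]

theorem trace_classMatrix (y : V → Fin k) :
    ((classMatrix y)ᵀ * G.lapMatrix ℝ * classMatrix y).trace = 2 * (cutSize G y : ℝ) := by
  have hcut : cutSize G y = {e ∈ G.edgeFinset | ¬ (e.map y).IsDiag}.card := by
    rw [cutSize, ← Set.ncard_coe_finset]
    simp
  rw [trace_transpose_mul_lapMatrix_mul, hcut]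
  simp only [sum_sqDiff_classMatrix_col, ← ite_not (p := Sym2.IsDiag _), ← Finset.sum_filter,
    Finset.sum_const, nsmul_eq_mul]
  ring

theorem cutComplexity_eq (y : V → Fin k) :
    cutComplexity G y = 2 * cutSize G y * sqRadius (G.lapMatrix ℝ) := by
  rw [cutComplexity, trace_classMatrix]

theorem cutComplexity_nonneg (y : V → Fin k) : 0 ≤ cutComplexity G y :=
  mul_nonneg (trace_transpose_mul_mul_nonneg (G.posSemidef_lapMatrix ℝ) _)
    (sqRadius_nonneg (G.posSemidef_lapMatrix ℝ))

theorem cutComplexity_le_two_mul_cutSize_mul_resDiam [Nonempty V] (y : V → Fin k) :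
    cutComplexity G y ≤ 2 * (cutSize G y * resDiam G) := by
  rw [cutComplexity_eq, mul_assoc]
  gcongr
  exact sqRadius_le_resDiam

theorem RowNormalized.trace_lapMatrix_le {P : Matrix V (Fin d) ℝ} (hP : RowNormalized P)
    (hPy : Function.FactorsThrough P y) :
    (Pᵀ * G.lapMatrix ℝ * P).trace ≤
      2 * ((classMatrix y)ᵀ * G.lapMatrix ℝ * classMatrix y).trace := by
  rw [trace_transpose_mul_lapMatrix_mul, trace_transpose_mul_lapMatrix_mul, Finset.mul_sum]
  exact Finset.sum_le_sum fun e _ => hP.sum_sqDiff_col_le hPy e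

theorem RowNormalized.sqRadius_mul_trace_pdLaplacian_le [Nontrivial V] (hG : G.Connected)
    {P : Matrix V (Fin d) ℝ} (hP : RowNormalized P) (hPy : Function.FactorsThrough P y) :
    sqRadius (pdLaplacian G) * (Pᵀ * pdLaplacian G * P).trace ≤ 4 * cutComplexity G y + 2 := by
  have hR := sqRadius_lapMatrix_pos hG
  rw [sqRadius_pdLaplacian hG, pdLaplacian, cutComplexity, Matrix.mul_add, Matrix.add_mul,
    trace_add, Matrix.mul_smul, Matrix.smul_mul, trace_smul, smul_eq_mul]
  set R := sqRadius (G.lapMatrix ℝ)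
  set S := (Pᵀ * (of fun _ _ => (1 : ℝ) : Matrix V V ℝ) * P).trace
  have hn : (0 : ℝ) < (Fintype.card V : ℝ) ^ 2 := by
    have := Fintype.card_pos (α := V)
    positivity
  have hones : R * (R⁻¹ * (1 / (Fintype.card V : ℝ) ^ 2) * S) ≤ 1 := by
    rw [← mul_assoc, mul_inv_cancel_left₀ hR.ne', one_div, inv_mul_le_one₀ hn]
    exact hP.trace_transpose_mul_ones_mul_le
  linarith [mul_le_mul_of_nonneg_left (hP.trace_lapMatrix_le (G := G) hPy) hR.le]

theorem quasiDim_pdLaplacian_le [Nontrivial V] (hG : G.Connected)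
    {Ustar : Matrix (Fin k) (Fin k) ℝ} {γ : ℝ}
    (hne : (quasiDimValues γ (pdLaplacian G) (pdLaplacian G)
      (classMatrix y * Ustar * (classMatrix y)ᵀ)).Nonempty) :
    quasiDim γ (pdLaplacian G) (pdLaplacian G) (classMatrix y * Ustar * (classMatrix y)ᵀ) ≤
      8 * cutComplexity G y + 4 := by
  obtain ⟨_, d, P, Q, hP, hQ, hPQ, -⟩ := hne
  obtain ⟨P', Q', hP', hQ', hPQ', hPy, hQy⟩ := exists_factorization_factorsThrough hP hQ hPQ
  have hpsd := (posDef_pdLaplacian hG).posSemidef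
  refine (quasiDim_le_sideCost hpsd hpsd hP' hQ' hPQ').trans ?_
  rw [sideCost]
  linarith [hP'.sqRadius_mul_trace_pdLaplacian_le hG hPy,
    hQ'.sqRadius_mul_trace_pdLaplacian_le hG hQy]

theorem one_le_four_mul_cutComplexity (hG : G.Connected) {u v : V} (huv : y u ≠ y v) :
    1 ≤ 4 * cutComplexity G y := by
  have hL := G.posSemidef_lapMatrix ℝ
  set x : V → ℝ := (classMatrix y).col (y u) with hx
  set t := ((classMatrix y)ᵀ * G.lapMatrix ℝ * classMatrix y).trace with ht
  have henergy : x ⬝ᵥ G.lapMatrix ℝ *ᵥ x ≤ t := by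
    rw [ht, trace_transpose_mul_mul]
    exact Finset.single_le_sum (f := fun s => (classMatrix y).col s ⬝ᵥ
      G.lapMatrix ℝ *ᵥ (classMatrix y).col s)
      (fun s _ => dotProduct_mulVec_nonneg_of_posSemidef hL _) (Finset.mem_univ (y u))
  calc 1 = (x u - x v) ^ 2 := by simp [hx, classMatrix, huv.symm]
    _ ≤ effRes G u v * (x ⬝ᵥ G.lapMatrix ℝ *ᵥ x) := sq_sub_le_effRes_mul hG x u v
    _ ≤ 4 * sqRadius (G.lapMatrix ℝ) * t := by
        gcongr
        · exact dotProduct_mulVec_nonneg_of_posSemidef hL _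
        · exact mul_nonneg (by norm_num) (sqRadius_nonneg hL)
        · exact effRes_le_four_mul_sqRadius u v
    _ = 4 * cutComplexity G y := by rw [cutComplexity]; ring

end Classes

section Estimates

variable {V : Type*} [Fintype V] [DecidableEq V]

theorem existsUnique_isFTRL_sideGamma {M N : Matrix V V ℝ} [Nonempty V] (hM : M.PosDef)
    (hN : N.PosDef) {Dhat : ℝ} (hne : (comparators M N Dhat).Nonempty) (η : ℝ)
    (A : Matrix (V ⊕ V) (V ⊕ V) ℝ) : ∃! W, IsFTRL (sideGamma M N) Dhat η A W := by
  obtain ⟨X, hX⟩ := hne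
  obtain ⟨W, hW, -⟩ :=
    exists_mem_decisionSet_of_mem_comparators hM.posSemidef hN.posSemidef hX
  exact existsUnique_isFTRL (isRegularizer_sideGamma hM hN) η A ⟨W, hW⟩

theorem quasiDim_nonneg {M N : Matrix V V ℝ} (hM : M.PosSemidef) (hN : N.PosSemidef) (γ : ℝ)
    (U : Matrix V V ℝ) : 0 ≤ quasiDim γ M N U := by
  refine Real.sInf_nonneg ?_
  rintro _ ⟨d, P, Q, -, -, -, rfl⟩
  exact sideCost_nonneg hM hN P Q

variable {G : SimpleGraph V} [DecidableRel G.Adj] {k : ℕ} {y : V → Fin k}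

theorem eight_mul_cutComplexity_add_four_le [Nonempty V] {b : ℝ}
    (hb : cutComplexity G y ≤ 2 * (b * k)) :
    8 * cutComplexity G y + 4 ≤ 48 * ((b + 1) * k) := by
  have hk : (1 : ℝ) ≤ k := by exact_mod_cast (y (Classical.arbitrary V)).pos
  linarith [cutComplexity_nonneg (G := G) y]

theorem cutComplexity_le_of_dist_le (hG : G.Connected) {a : ℝ} {d : ℕ}
    (ha : (cutSize G y : ℝ) ≤ a * k) (hd : ∀ u v, G.dist u v ≤ d) :
    cutComplexity G y ≤ 2 * (a * d * k) := by
  have := hG.nonempty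
  calc cutComplexity G y ≤ 2 * (cutSize G y * resDiam G) :=
        cutComplexity_le_two_mul_cutSize_mul_resDiam y
    _ ≤ 2 * (cutSize G y * d) := by gcongr; exact resDiam_le_of_dist_le hG hd
    _ ≤ 2 * (a * k * d) := by gcongr
    _ = 2 * (a * d * k) := by ring

end Estimates

end OnlineSimilarity

theorem mainTheorem5_general {V : Type*} [Fintype V] [DecidableEq V] [Nontrivial V]
    {G : SimpleGraph V} [DecidableRel G.Adj] (hG : G.Connected) {Lbar : Matrix V V ℝ}
    (hLbar : Lbar = pdLaplacian G) {k : ℕ} (y : V → Fin k) {c δ : ℝ} (hc : 0 < c)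
    (hc8 : c ≤ 1 / 8) (hcδ : 8 * c ≤ δ) :
    (((classMatrix y)ᵀ * G.lapMatrix ℝ * classMatrix y).trace = 2 * (cutSize G y : ℝ) ∧
      sqRadius (G.lapMatrix ℝ) ≤ resDiam G ∧ resDiam G ≤ 4 * sqRadius (G.lapMatrix ℝ)) ∧
    (∀ γ : ℝ, 0 < γ → γ ≤ 1 / 3 → (quasiDimValues γ Lbar Lbar (simMatrix y)).Nonempty) ∧
    ∀ (Ustar : Matrix (Fin k) (Fin k) ℝ) (U : Matrix V V ℝ),
      U = classMatrix y * Ustar * (classMatrix y)ᵀ →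
      ∀ γ : ℝ, 0 < γ → γ ≤ 1 → (quasiDimValues γ Lbar Lbar U).Nonempty →
    (∀ Dhat : ℝ, quasiDim γ Lbar Lbar U ≤ Dhat →
      (∀ A : Matrix (V ⊕ V) (V ⊕ V) ℝ,
        ∃! W, IsFTRL (sideGamma Lbar Lbar) Dhat (c * γ ^ 2) A W) ∧
      γ • U ∈ comparators Lbar Lbar Dhat ∧
      (∀ (T : ℕ) (i j : ℕ → V) (lab : ℕ → ℝ),
        minHingeLoss γ Lbar Lbar Dhat T i j lab ∈
          hingeLoss γ T i j lab '' comparators Lbar Lbar Dhat) ∧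
      MistakeBound Lbar U γ Dhat (c * γ ^ 2) δ (96 * (1 / c + 1) * Dhat / γ ^ 2)) ∧
    ∀ Dhat : ℝ, Dhat = 8 * cutComplexity G y + 4 →
      quasiDim γ Lbar Lbar U ≤ Dhat ∧
      ((∃ u v, y u ≠ y v) →
        MistakeBound Lbar U γ Dhat (c * γ ^ 2) δ
          (96 * (1 / c + 1) * cutComplexity G y / γ ^ 2) ∧
        MistakeBound Lbar U γ Dhat (c * γ ^ 2) δ
          (96 * (1 / c + 1) * ((cutSize G y : ℝ) * resDiam G) / γ ^ 2)) ∧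
      (∀ a : ℝ, cutComplexity G y ≤ a * (k : ℝ) →
        MistakeBound Lbar U γ Dhat (c * γ ^ 2) δ
          (96 * (1 / c + 1) * (a + 1) * (k : ℝ) / γ ^ 2)) ∧
      (∀ (a : ℝ) (d : ℕ), (cutSize G y : ℝ) ≤ a * (k : ℝ) → (∀ u v, G.dist u v ≤ d) →
        MistakeBound Lbar U γ Dhat (c * γ ^ 2) δ
          (96 * (1 / c + 1) * (a * (d : ℝ) + 1) * (k : ℝ) / γ ^ 2)) := by
  subst hLbar
  have hL := posDef_pdLaplacian hG
  refine ⟨⟨trace_classMatrix y, sqRadius_le_resDiam, resDiam_le_four_mul_sqRadius⟩,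
    fun γ hγ => quasiDimValues_simMatrix_nonempty _ _ y hγ.le, ?_⟩
  rintro Ustar _ rfl γ hγ hγ1 hne
  have hbound {Dhat Y : ℝ} := mistakeBound_of_quasiDim_le (Dhat := Dhat) (Y := Y) hL hγ hγ1 hc
    hc8 hcδ hne
  constructor
  · intro Dhat hD
    have hmem := smul_mem_comparators_of_quasiDim_le hL.posSemidef hL.posSemidef hne hD
    have hD0 : 0 ≤ Dhat := (quasiDim_nonneg hL.posSemidef hL.posSemidef γ _).trans hD
    exact ⟨existsUnique_isFTRL_sideGamma hL hL ⟨_, hmem⟩ _, hmem,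
      minHingeLoss_mem hL.posSemidef hL.posSemidef hγ ⟨_, hmem⟩, hbound hD (by linarith)⟩
  · rintro _ rfl
    have hD := quasiDim_pdLaplacian_le hG hne
    simp only [mul_assoc (96 * (1 / c + 1)) _ (k : ℝ)]
    refine ⟨hD, ?_, fun a ha => hbound hD (eight_mul_cutComplexity_add_four_le ?_),
      fun a d ha hd => hbound hD (eight_mul_cutComplexity_add_four_le
        (cutComplexity_le_of_dist_le hG ha hd))⟩
    · rintro ⟨u, v, huv⟩
      have hone := one_le_four_mul_cutComplexity hG huv
      have hcut := cutComplexity_le_two_mul_cutSize_mul_resDiam (G := G) y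
      exact ⟨hbound hD (by linarith), hbound hD (by linarith)⟩
    · linarith [cutComplexity_nonneg (G := G) y]

theorem mainTheorem5 :
    ∀ δ : ℝ, 0 < δ → ∃ c₀ : ℝ, 0 < c₀ ∧ ∀ c : ℝ, 0 < c → c ≤ c₀ → ∃ C : ℝ, 0 < C ∧
      ∀ (n : ℕ), 2 ≤ n → ∀ (G : SimpleGraph (Fin n)) [DecidableRel G.Adj], G.Connected →
      ∀ Lbar : Matrix (Fin n) (Fin n) ℝ, Lbar = pdLaplacian G →
      ∀ (k : ℕ) (y : Fin n → Fin k),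
        -- trace and radius against cut-size and resistance diameter
        (((classMatrix y)ᵀ * G.lapMatrix ℝ * classMatrix y).trace = 2 * (cutSize G y : ℝ) ∧
          sqRadius (G.lapMatrix ℝ) ≤ resDiam G ∧
          resDiam G ≤ 4 * sqRadius (G.lapMatrix ℝ)) ∧
        -- margins up to `1/3` are feasible for the similarity matrix of the classes
        (∀ γ : ℝ, 0 < γ → γ ≤ 1 / 3 →
          (quasiDimValues γ Lbar Lbar (simMatrix y)).Nonempty) ∧
        ∀ (Ustar : Matrix (Fin k) (Fin k) ℝ) (U : Matrix (Fin n) (Fin n) ℝ),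
          (∀ r s, Ustar r s = 1 ∨ Ustar r s = -1) →
          U = classMatrix y * Ustar * (classMatrix y)ᵀ →
        ∀ γ : ℝ, 0 < γ →
          (quasiDimValues γ Lbar Lbar U).Nonempty →
        -- any estimate of the quasi-dimension
        (∀ Dhat : ℝ,
          quasiDim γ Lbar Lbar U ≤ Dhat →
          (∀ A : Matrix (Fin n ⊕ Fin n) (Fin n ⊕ Fin n) ℝ, ∃! W,
            IsFTRL (sideGamma Lbar Lbar) Dhat (c * γ ^ 2) A W) ∧
          γ • U ∈ comparators Lbar Lbar Dhat ∧
          (∀ (T : ℕ) (i j : ℕ → Fin n) (lab : ℕ → ℝ),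
            minHingeLoss γ Lbar Lbar Dhat T i j lab ∈
            hingeLoss γ T i j lab '' comparators Lbar Lbar Dhat) ∧
          MistakeBound Lbar U γ Dhat (c * γ ^ 2) δ
            (C * Dhat / γ ^ 2)) ∧
        -- the explicit estimate `8 Tr(Rᵀ L R) R_L + 4`
        ∀ Dhat : ℝ, Dhat = 8 * cutComplexity G y + 4 →
          quasiDim γ Lbar Lbar U ≤ Dhat ∧
          ((∃ u v, y u ≠ y v) →
            MistakeBound Lbar U γ Dhat (c * γ ^ 2) δ
              (C * cutComplexity G y / γ ^ 2) ∧
            MistakeBound Lbar U γ Dhat (c * γ ^ 2) δ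
              (C * ((cutSize G y : ℝ) * resDiam G) / γ ^ 2)) ∧
          (∀ a : ℝ, cutComplexity G y ≤ a * (k : ℝ) →
            MistakeBound Lbar U γ Dhat (c * γ ^ 2) δ
              (C * (a + 1) * (k : ℝ) / γ ^ 2)) ∧
          (∀ (a : ℝ) (d : ℕ), (cutSize G y : ℝ) ≤ a * (k : ℝ) →
            (∀ u v, G.dist u v ≤ d) →
            MistakeBound Lbar U γ Dhat (c * γ ^ 2) δ
              (C * (a * (d : ℝ) + 1) * (k : ℝ) / γ ^ 2)) := by
  intro δ hδ
  refine ⟨min 1 δ / 8, by positivity, fun c hc hcle => ⟨96 * (1 / c + 1), by positivity, ?_⟩⟩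
  have hc8 : c ≤ 1 / 8 := by linarith [min_le_left 1 δ]
  have hcδ : 8 * c ≤ δ := by linarith [min_le_right 1 δ]
  intro n hn G _ hG Lbar hLbar k y
  have : Nontrivial (Fin n) := Fin.nontrivial_iff_two_le.mpr hn
  obtain ⟨hgraph, hfeasible, hmistakes⟩ := mainTheorem5_general hG hLbar y hc hc8 hcδ
  refine ⟨hgraph, hfeasible, fun Ustar U hUstar hU γ hγ hne => ?_⟩
  have hentry : U ⟨0, by omega⟩ ⟨0, by omega⟩ = 1 ∨ U ⟨0, by omega⟩ ⟨0, by omega⟩ = -1 := by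
    rw [hU, classMatrix_mul_mul_transpose_apply]
    exact hUstar _ _
  exact hmistakes Ustar U hU γ hγ (margin_le_one hγ hentry hne) hne
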